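/- All rings are commutative and noetherian and all modules are finitely generated. For a ring $R$, let $\mathrm{G}(R)$ be the Grothendieck group of $R$-modules, and let $\mathrm{h}(R)$ be the quotient of $\mathrm{G}(R)$ by the subgroup generated by the classes of pseudo-zero modules, i.e. modules $M$ with $M_{\mathfrak p}=0$ for every prime $\mathfrak p$ of height at most one; put $\mathrm{h}(R)_{\mathbb R}=\mathrm{h}(R)\otimes_{\mathbb Z}\mathbb R$. An $R$-module $M$ is maximal Cohen–Macaulay (MCM) if $\operatorname{depth}M_{\mathfrak p}\ge\operatorname{ht}\mathfrak p$ for all primes $\mathfrak p$ (with $\operatorname{depth}0=\infty$), and $\mathrm{c}(R)=\sum_{M\ \mathrm{MCM}}\mathbb R_{\ge0}[M]\subseteq\mathrm{h}(R)_{\mathbb R}$. A convex cone is polyhedral if it is spanned by finitely many vectors. A module $M$ is locally free in codimension one if $M_{\mathfrak p}$ is free for all primes $\mathfrak p$ of height one. When $R$ is local, $\Omega^n_RM$ and $\beta_n^R(M)$ denote the $n$th syzygy and the $n$th Betti number in the minimal free resolution of $M$, and the complexity $\operatorname{cx}_RM\in\mathbb N\cup\{\infty\}$ is the infimum of the integers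 $n\ge0$ for which there is a real number $\alpha\ge0$ with $\beta_i^R(M)\le\alpha\, i^{\,n-1}$ for all $i\gg0$. **Theorem.** Let $R\subseteq S$ be a finite extension of Cohen–Macaulay local domains. Suppose that $R$ is normal, that $\mathrm{h}(S)_{\mathbb R}$ is finite-dimensional, and that $\mathrm{c}(S)$ is polyhedral. Let $f:\mathrm{h}(S)_{\mathbb R}\to\mathrm{h}(R)_{\mathbb R}$ be the natural $\mathbb R$-linear map sending the class of an $S$-module $X$ to the class of $X$ regarded as an $R$-module, and put $V=f(\mathrm{c}(S))$. Then $f$ is surjective and $V$ is a polyhedral subcone of $\mathrm{c}(R)$. Moreover, let $M$ be an $R$-module with $\operatorname{cx}_RM\ge2$ which is locally free in codimension one. Then $[\Omega_R^nM]\in V$ for infinitely many $n\in\mathbb N$, if either of the following two conditions holds. 1. There exists an $S$-module $N$, locally free in codimension one as an $R$-module, such that $[N\oplus N^*]$ lies in the interior of $\mathrm{c}(S)$ in $\mathrm{h}(S)_{\mathbb R}$, where $N^*=\operatorname{Hom}_R(N,R)$ is regarded as an $S$-module. 2. The $R$-module $\operatorname{Hom}_R(S,R)$ is maximal Cohen–Macaulay.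 -/

import Mathlib

universe u

namespace GrothendieckCone

/-! ### The Grothendieck group modulo pseudo-zero modules -/

section Groups

variable (R : Type u) [CommRing R]

/-- The defining relations `[M₂] - [M₁] - [M₃]` of the Grothendieck group, one for each short exact
sequence `0 → M₁ → M₂ → M₃ → 0` of finitely generated modules. -/
def exactRelations : Set (FreeAbelianGroup (FGModuleCat.{u} R)) :=
  {x | ∃ (M₁ M₂ M₃ : FGModuleCat.{u} R) (f : M₁ →ₗ[R] M₂) (g : M₂ →ₗ[R] M₃),
    Function.Injective f ∧ Function.Exact f g ∧ Function.Surjective g ∧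
    x = FreeAbelianGroup.of M₂ - FreeAbelianGroup.of M₁ - FreeAbelianGroup.of M₃}

/-- The Grothendieck group `G(R)` of finitely generated `R`-modules. -/
abbrev G : Type (u + 1) :=
  FreeAbelianGroup (FGModuleCat.{u} R) ⧸ AddSubgroup.closure (exactRelations R)

/-- The class of a finitely generated module in `G(R)`. -/
def gClass (M : FGModuleCat.{u} R) : G R :=
  QuotientAddGroup.mk' (AddSubgroup.closure (exactRelations R)) (FreeAbelianGroup.of M)

/-- A module is pseudo-zero if its localization at every prime of height at most one vanishes. -/
def IsPseudoZero (M : Type*) [AddCommGroup M] [Module R M] : Prop :=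
  ∀ (p : Ideal R) [p.IsPrime], p.height ≤ 1 → Subsingleton (LocalizedModule p.primeCompl M)

/-- The subgroup of `G(R)` generated by the classes of pseudo-zero modules. -/
def pseudoZeroSubgroup : AddSubgroup (G R) :=
  AddSubgroup.closure {x | ∃ M : FGModuleCat.{u} R, IsPseudoZero R M ∧ x = gClass R M}

/-- The group `H(R)`: the quotient of `G(R)` by the subgroup generated by pseudo-zero modules. -/
abbrev H : Type (u + 1) := G R ⧸ pseudoZeroSubgroup R

/-- The class of a finitely generated module in `H(R)`. -/
def hClass (M : FGModuleCat.{u} R) : H R :=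
  QuotientAddGroup.mk' (pseudoZeroSubgroup R) (gClass R M)

/-- The real vector space `H(R)_ℝ = ℝ ⊗_ℤ H(R)`. -/
abbrev HReal : Type (u + 1) := TensorProduct ℤ ℝ (H R)

/-- The class of a finitely generated module in `H(R)_ℝ`. -/
noncomputable def realClass (M : Type u) [AddCommGroup M] [Module R M] [Module.Finite R M] :
    HReal R :=
  TensorProduct.tmul ℤ (1 : ℝ) (hClass R (FGModuleCat.of R M))

end Groups

/-! ### Depth, maximal Cohen-Macaulay modules, and the Cohen-Macaulay cone -/

section CohenMacaulay

/-- The depth of a finitely generated module over a noetherian local ring: the supremum of the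
lengths of the weakly regular sequences contained in the maximal ideal. For a nonzero module these
are the regular sequences, by Nakayama; the zero module has depth `∞`. -/
noncomputable def depth (A : Type*) [CommRing A] [IsLocalRing A] (M : Type*) [AddCommGroup M]
    [Module A M] : ℕ∞ :=
  ⨆ (rs : List A) (_ : (∀ r ∈ rs, r ∈ IsLocalRing.maximalIdeal A) ∧
    RingTheory.Sequence.IsWeaklyRegular M rs), (rs.length : ℕ∞)

variable (R : Type u) [CommRing R]

/-- A finitely generated module `M` is maximal Cohen-Macaulay if `depth M_p ≥ height p` for all
prime ideals `p`. -/
def IsMCM (M : Type*) [AddCommGroup M] [Module R M] : Prop :=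
  ∀ (p : Ideal R) [p.IsPrime],
    p.height ≤ depth (Localization.AtPrime p) (LocalizedModule p.primeCompl M)

/-- A noetherian ring is Cohen-Macaulay if each of its localizations at a prime ideal is a
Cohen-Macaulay local ring, that is, has depth equal to its dimension. -/
def IsCohenMacaulay : Prop :=
  ∀ (p : Ideal R) [p.IsPrime], depth (Localization.AtPrime p) (Localization.AtPrime p) = p.height

/-- The cone `C(R) = ∑ ℝ≥0 [M]` in `H(R)_ℝ` spanned by the maximal Cohen-Macaulay modules. -/
noncomputable def cmCone : PointedCone ℝ (HReal R) :=
  PointedCone.hull ℝ {x | ∃ M : FGModuleCat.{u} R, IsMCM R M ∧ x = realClass R M}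

/-- A convex cone is polyhedral if it is spanned by finitely many vectors. -/
def IsPolyhedral {E : Type*} [AddCommGroup E] [Module ℝ E] (C : PointedCone ℝ E) : Prop :=
  ∃ t : Finset E, C = PointedCone.hull ℝ (t : Set E)

/-- The interior of a cone in a finite-dimensional real vector space. On such a space the module
topology is the Euclidean topology given by any choice of a basis. -/
def coneInterior {E : Type*} [AddCommGroup E] [Module ℝ E] (C : PointedCone ℝ E) : Set E :=
  letI : TopologicalSpace E := moduleTopology ℝ E
  interior (C : Set E)

/-- A module `M` is locally free in codimension one if `M_p` is free for all primes `p` of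
height one. -/
def IsLocallyFreeInCodimOne (M : Type*) [AddCommGroup M] [Module R M] : Prop :=
  ∀ (p : Ideal R) [p.IsPrime], p.height = 1 →
    Module.Free (Localization.AtPrime p) (LocalizedModule p.primeCompl M)

end CohenMacaulay

/-! ### Minimal free resolutions, Betti numbers and complexity -/

section Syzygies

variable (R : Type u) [CommRing R]

/-- The minimal number of generators of a finitely generated module. -/
noncomputable def minGen (M : FGModuleCat.{u} R) : ℕ := (⊤ : Submodule R M).spanFinrank

theorem exists_minimalGenerators (M : FGModuleCat.{u} R) :
    ∃ x : Fin (minGen R M) → M, Submodule.span R (Set.range x) = ⊤ := by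
  obtain ⟨s, hs, hsp⟩ := Submodule.FG.exists_span_finset_card_eq_spanFinrank
    (Module.Finite.fg_top (R := R) (M := M))
  refine ⟨fun i => (s.equivFinOfCardEq hs).symm i, ?_⟩
  refine Eq.trans (congrArg (Submodule.span R) (Set.ext fun y => ?_)) hsp
  constructor
  · rintro ⟨i, rfl⟩
    exact ((s.equivFinOfCardEq hs).symm i).2
  · intro hy
    exact ⟨s.equivFinOfCardEq hs ⟨y, hy⟩,
      congrArg Subtype.val ((s.equivFinOfCardEq hs).symm_apply_apply ⟨y, hy⟩)⟩

/-- A minimal system of generators. -/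
noncomputable def minimalGenerators (M : FGModuleCat.{u} R) : Fin (minGen R M) → M :=
  (exists_minimalGenerators R M).choose

/-- The free cover `R^μ → M` given by a minimal system of generators. Over a local ring this is
the (unique up to isomorphism) minimal free cover. -/
noncomputable def minimalCover (M : FGModuleCat.{u} R) : (Fin (minGen R M) → R) →ₗ[R] M :=
  Fintype.linearCombination R (minimalGenerators R M)

variable [IsNoetherianRing R]

/-- The first syzygy: the kernel of the minimal free cover. -/
noncomputable def firstSyzygy (M : FGModuleCat.{u} R) : FGModuleCat.{u} R :=
  FGModuleCat.of R (LinearMap.ker (minimalCover R M))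

/-- The `n`-th syzygy `Ωⁿ M`. Over a local ring, splicing the sequences
`0 → Ωⁿ⁺¹ M → R^(β n) → Ωⁿ M → 0` gives the minimal free resolution of `M`. -/
noncomputable def syzygy (n : ℕ) (M : FGModuleCat.{u} R) : FGModuleCat.{u} R :=
  (firstSyzygy R)^[n] M

/-- The `n`-th Betti number of `M`: the rank of the `n`-th free module in the minimal free
resolution. -/
noncomputable def betti (n : ℕ) (M : FGModuleCat.{u} R) : ℕ := minGen R (syzygy R n M)

/-- The complexity of `M`: the infimum of the `n ≥ 0` for which there is a real `α ≥ 0` with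
`β i ≤ α * i ^ (n - 1)` for all sufficiently large `i`. It is `∞` if there is no such `n`. -/
noncomputable def complexity (M : FGModuleCat.{u} R) : ℕ∞ :=
  ⨅ (n : ℕ) (_ : ∃ α : ℝ, 0 ≤ α ∧ ∀ᶠ i : ℕ in Filter.atTop,
    (betti R i M : ℝ) ≤ α * (i : ℝ) ^ ((n : ℤ) - 1)), (n : ℕ∞)

end Syzygies

/-! ### Restriction of scalars along a finite extension -/

section Extension

variable (R S : Type u) [CommRing R] [CommRing S] [Algebra R S]

/-- An `S`-module regarded as an `R`-module through the structure map `R → S`. -/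
def restrictObj [Module.Finite R S] (X : FGModuleCat.{u} S) : FGModuleCat.{u} R :=
  letI : Module R X := Module.compHom X (algebraMap R S)
  haveI : IsScalarTower R S X :=
    IsScalarTower.of_algebraMap_smul fun _ _ => rfl
  haveI : Module.Finite R X := Module.Finite.trans S X
  FGModuleCat.of R X

theorem height_le_height_comap [Algebra.IsIntegral R S] (q : Ideal S) [q.IsPrime] :
    q.height ≤ (q.comap (algebraMap R S)).height := by
  have h := Order.height_le_height_apply_of_strictMono (PrimeSpectrum.comap (algebraMap R S))
    (fun I J h => Ideal.IsIntegral.comap_lt_comap (I := I.asIdeal) (J := J.asIdeal) h) ⟨q, ‹_›⟩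
  rwa [← PrimeSpectrum.height_eq_orderHeight, ← PrimeSpectrum.height_eq_orderHeight] at h

theorem IsPseudoZero.restrict [Module.Finite R S] (X : FGModuleCat.{u} S)
    (hX : IsPseudoZero S X) : IsPseudoZero R (restrictObj R S X) := by
  intro p hp hht
  by_contra hne
  rw [not_subsingleton_iff_nontrivial] at hne
  have hsupp : (⟨p, hp⟩ : PrimeSpectrum R) ∈ Module.support R (restrictObj R S X) := hne
  have hann : Module.annihilator R (restrictObj R S X) ≤ p :=
    Module.annihilator_le_of_mem_support hsupp
  have hle : (Module.annihilator S X).comap (algebraMap R S) ≤ p := by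
    refine le_trans ?_ hann
    intro r hr
    rw [Module.mem_annihilator]
    intro x
    exact Module.mem_annihilator.mp (Ideal.mem_comap.mp hr) (show (X : Type u) from x)
  obtain ⟨q, hq, hqp, hqc⟩ := Ideal.exists_ideal_over_prime_of_isIntegral p _ hle
  have h1 : q.height ≤ 1 := by
    refine (height_le_height_comap R S q).trans ?_
    rwa [hqc]
  have h2 : (⟨q, hqp⟩ : PrimeSpectrum S) ∈ Module.support S X :=
    Module.mem_support_iff_of_finite.mpr hq
  have h3 : Nontrivial (LocalizedModule q.primeCompl X) := h2
  exact not_subsingleton_iff_nontrivial.mpr h3 (hX q h1)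

variable [Module.Finite R S]

/-- Restriction of scalars `G(S) → G(R)`, `[X] ↦ [X]`. -/
noncomputable def gRestrict : G S →+ G R :=
  QuotientAddGroup.lift _ (FreeAbelianGroup.lift fun X => gClass R (restrictObj R S X)) (by
    rw [AddSubgroup.closure_le]
    rintro _ ⟨M₁, M₂, M₃, f, g, hf, hfg, hg, rfl⟩
    simp only [SetLike.mem_coe, AddMonoidHom.mem_ker, map_sub, FreeAbelianGroup.lift_apply_of]
    unfold gClass
    rw [← map_sub, ← map_sub]
    refine (QuotientAddGroup.eq_zero_iff _).mpr (AddSubgroup.subset_closure ?_)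
    exact ⟨restrictObj R S M₁, restrictObj R S M₂, restrictObj R S M₃,
      ⟨⟨f, f.map_add⟩, fun r x => f.map_smul (algebraMap R S r) x⟩,
      ⟨⟨g, g.map_add⟩, fun r x => g.map_smul (algebraMap R S r) x⟩, hf, hfg, hg, rfl⟩)

/-- Restriction of scalars `H(S) → H(R)`, `[X] ↦ [X]`. -/
noncomputable def hRestrict : H S →+ H R :=
  QuotientAddGroup.map _ (pseudoZeroSubgroup R) (gRestrict R S) (by
    rw [pseudoZeroSubgroup, AddSubgroup.closure_le]
    rintro _ ⟨M, hM, rfl⟩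
    refine AddSubgroup.subset_closure ⟨restrictObj R S M, hM.restrict R S M, ?_⟩
    simp [gRestrict, gClass])

/-- The natural `ℝ`-linear map `H(S)_ℝ → H(R)_ℝ`, `[X] ↦ [X]`. -/
noncomputable def realRestrict : HReal S →ₗ[ℝ] HReal R :=
  (hRestrict R S).toIntLinearMap.baseChange ℝ

/-- The image `V` of the cone `C(S)` under the natural map `H(S)_ℝ → H(R)_ℝ`. -/
noncomputable def imageCone : PointedCone ℝ (HReal R) :=
  (cmCone S).map (realRestrict R S)

end Extension

/-! ### The `R`-dual of an `S`-module -/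

section Dual

/-- The `R`-dual `N* = Hom_R(N, R)` of an `S`-module `N`, with its `S`-module structure
`(s • φ) x = φ (s • x)`. -/
def RDual (R _S N : Type u) [CommRing R] [AddCommGroup N] [Module R N] : Type u := N →ₗ[R] R

variable (R S : Type u) [CommRing R] [CommRing S] [Algebra R S]
variable (N : Type u) [AddCommGroup N] [Module R N] [Module S N] [IsScalarTower R S N]

instance : AddCommGroup (RDual R S N) := inferInstanceAs (AddCommGroup (N →ₗ[R] R))

instance : Module R (RDual R S N) := inferInstanceAs (Module R (N →ₗ[R] R))

instance : Module S (RDual R S N) where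
  smul s φ := LinearMap.comp (show N →ₗ[R] R from φ) (Algebra.lsmul R R N s)
  one_smul φ := LinearMap.ext fun x => congrArg (show N →ₗ[R] R from φ) (one_smul S x)
  mul_smul s t φ := LinearMap.ext fun x => congrArg (show N →ₗ[R] R from φ)
    (show (s * t) • x = t • s • x by rw [mul_comm, mul_smul])
  smul_zero _ := rfl
  smul_add _ _ _ := rfl
  add_smul s t φ := LinearMap.ext fun x =>
    (congrArg (show N →ₗ[R] R from φ) (add_smul s t x)).trans
      ((show N →ₗ[R] R from φ).map_add _ _)
  zero_smul φ := LinearMap.ext fun x =>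
    (congrArg (show N →ₗ[R] R from φ) (zero_smul S x)).trans
      ((show N →ₗ[R] R from φ).map_zero)

theorem RDual.smul_apply (s : S) (φ : RDual R S N) (x : N) :
    (show N →ₗ[R] R from s • φ) x = (show N →ₗ[R] R from φ) (s • x) := rfl

instance : IsScalarTower R S (RDual R S N) :=
  IsScalarTower.of_algebraMap_smul fun r φ => LinearMap.ext fun x =>
    (congrArg (show N →ₗ[R] R from φ) (algebraMap_smul S r x)).trans
      ((show N →ₗ[R] R from φ).map_smul r x)

instance [IsNoetherianRing R] [Module.Finite R S] [Module.Finite S N] :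
    Module.Finite S (RDual R S N) := by
  have : Module.Finite R N := Module.Finite.trans S N
  obtain ⟨n, g, hg⟩ := Module.Finite.exists_fin' R N
  have : Module.Finite R (N →ₗ[R] R) :=
    Module.Finite.of_injective (LinearMap.lcomp R R g) (fun φ ψ h => by
      refine LinearMap.ext fun x => ?_
      obtain ⟨y, rfl⟩ := hg x
      exact LinearMap.congr_fun h y)
  have : Module.Finite R (RDual R S N) := inferInstanceAs (Module.Finite R (N →ₗ[R] R))
  exact Module.Finite.of_restrictScalars_finite R S _

end Dual

end GrothendieckCone

/-! In `H(R)_ℝ` one has `[Ωⁿ M] = bₙ [R] + (-1)ⁿ [M]`, where `bₙ` (`bettiSum`) satisfies `bₙ + bₙ₊₁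
= βₙ`. If the `bₙ` were eventually bounded above, the Betti numbers would be bounded and the
complexity at most one. Hence, for complexity at least two, `bₙ` exceeds any given constant
infinitely often. It remains to see that `[R]` is an order unit of `V`: every `w` lies in `V` after
adding a multiple of `[R]`. Taking `w = ±[M]` then finishes the proof
(`infinite_setOf_realClass_syzygy_mem`).

Since `f` is surjective, an order unit of `c(S)` maps to an order unit of `V`, so one is sought
whose image is a multiple of `[R]`. Duality supplies it: over a normal domain `[N] + [N*] = 2k [R]`
in `H(R)` if `N` is torsion-free in codimension one (`exists_cls_add_cls_dual`), because `N` and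
`N*` have opposite divisor classes. Under condition 1, `[N ⊕ N*]` is an order unit as an interior
point. Under condition 2, take `N = S`: `[S]` is an order unit because high syzygies over `S` are
maximal Cohen–Macaulay (`mem_absorbed_realClass`), and adding `[Hom_R(S, R)] ∈ c(S)` keeps this.

Surjectivity of `f` is noetherian induction on primes with lying over (`realRestrict_surjective`).
The inclusion `V ≤ c(R)` holds since going down preserves heights and the depth at `p` is controlled
by the depths at the primes over `p` (`IsMCM.restrictScalars`). Polyhedrality is inherited by linear
images. -/

namespace GrothendieckCone

/-! ### Regular sequences and the depth lemma. -/

open RingTheory.Sequence in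
/-- The ideal `I` contains a weakly `M`-regular sequence of length `n`. -/
def HasRegularSequence {A : Type*} [CommRing A] (I : Ideal A) (n : ℕ) (M : Type*)
    [AddCommGroup M] [Module A M] : Prop :=
  ∃ rs : List A, rs.length = n ∧ (∀ r ∈ rs, r ∈ I) ∧ IsWeaklyRegular M rs

namespace HasRegularSequence

variable {A : Type*} [CommRing A] {I : Ideal A} {n : ℕ}
variable {M N F : Type*} [AddCommGroup M] [Module A M] [AddCommGroup N] [Module A N]
  [AddCommGroup F] [Module A F]

theorem zero : HasRegularSequence I 0 M :=
  ⟨[], rfl, by simp, by simp⟩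

theorem succ_iff : HasRegularSequence I (n + 1) M ↔
    ∃ x ∈ I, IsSMulRegular M x ∧ HasRegularSequence I n (QuotSMulTop x M) := by
  constructor
  · rintro ⟨rs, hl, hI, hr⟩
    match rs with
    | [] => simp at hl
    | x :: rs =>
      rw [RingTheory.Sequence.isWeaklyRegular_cons_iff] at hr
      exact ⟨x, hI x (by simp), hr.1, rs, by simpa using hl, fun r h => hI r (by simp [h]), hr.2⟩
  · rintro ⟨x, hx, hr, rs, hl, hI, hw⟩
    refine ⟨x :: rs, by simp [hl], ?_, ?_⟩
    · simpa [hx] using hI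
    · rw [RingTheory.Sequence.isWeaklyRegular_cons_iff]
      exact ⟨hr, hw⟩

theorem of_equiv (e : M ≃ₗ[A] N) (h : HasRegularSequence I n M) : HasRegularSequence I n N := by
  obtain ⟨rs, hl, hI, hw⟩ := h
  exact ⟨rs, hl, hI, (e.isWeaklyRegular_congr rs).mp hw⟩

theorem mono {m : ℕ} (hmn : m ≤ n) (h : HasRegularSequence I n M) : HasRegularSequence I m M := by
  obtain ⟨rs, hl, hI, hw⟩ := h
  refine ⟨rs.take m, by simp [hl, hmn], fun r hr => hI r (List.mem_of_mem_take hr), ?_⟩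
  rw [← List.take_append_drop m rs, RingTheory.Sequence.isWeaklyRegular_append_iff] at hw
  exact hw.1

theorem of_flat [Module.Flat A M] (h : HasRegularSequence I n A) : HasRegularSequence I n M := by
  obtain ⟨rs, hl, hI, hw⟩ := h
  exact ⟨rs, hl, hI, ((TensorProduct.rid A M).isWeaklyRegular_congr rs).mp
    (hw.isWeaklyRegular_lTensor (M₂ := M))⟩

end HasRegularSequence

section Depth

variable {A : Type*} [CommRing A]

/-- Regular sequences can be truncated, so a supremum of at least `n` is witnessed by a sequence of
length exactly `n`. -/
theorem le_depth_iff [IsLocalRing A] (M : Type*) [AddCommGroup M] [Module A M] (n : ℕ) :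
    (n : ℕ∞) ≤ depth A M ↔ HasRegularSequence (IsLocalRing.maximalIdeal A) n M := by
  constructor
  · intro h
    by_contra hn
    cases n with
    | zero => exact hn .zero
    | succ n =>
      have : depth A M ≤ n := by
        refine iSup₂_le fun rs hrs => ?_
        by_contra hlt
        have h1 : n + 1 ≤ rs.length := by
          have : (n : ℕ∞) < rs.length := not_le.mp hlt
          exact_mod_cast this
        exact hn (HasRegularSequence.mono h1 ⟨rs, rfl, hrs.1, hrs.2⟩)
      have h2 : ((n + 1 : ℕ) : ℕ∞) ≤ (n : ℕ∞) := h.trans this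
      have : n + 1 ≤ n := by exact_mod_cast h2
      omega
  · rintro ⟨rs, rfl, hI, hw⟩
    exact le_iSup₂_of_le (f := fun (rs : List A) (_ : (∀ r ∈ rs, r ∈ IsLocalRing.maximalIdeal A) ∧
      RingTheory.Sequence.IsWeaklyRegular M rs) => (rs.length : ℕ∞)) rs ⟨hI, hw⟩ le_rfl

end Depth

section Regular

variable {A : Type*} [CommRing A] {I : Ideal A}
variable {M N F : Type*} [AddCommGroup M] [Module A M] [AddCommGroup N] [Module A N]
  [AddCommGroup F] [Module A F]

/-- Prime avoidance: the zero divisors on `M` are the union of finitely many associated primes. -/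
theorem exists_le_associatedPrime [IsNoetherianRing A] [Module.Finite A M]
    (h : ∀ x ∈ I, ¬ IsSMulRegular M x) : ∃ P ∈ associatedPrimes A M, I ≤ P := by
  refine (I.subset_union_prime_finite (associatedPrimes.finite A M) (f := id) 0 0
    fun _ h _ _ ↦ h.isPrime).1 ?_
  simp_rw [id, biUnion_associatedPrimes_eq_compl_regular]
  exact fun x hx => h x hx

theorem exists_annihilated_of_forall_not_isSMulRegular [IsNoetherianRing A] [Module.Finite A M]
    (h : ∀ x ∈ I, ¬ IsSMulRegular M x) : ∃ m : M, m ≠ 0 ∧ ∀ r ∈ I, r • m = 0 := by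
  obtain ⟨P, hP, hle⟩ := exists_le_associatedPrime h
  rw [AssociatedPrimes.mem_iff, isAssociatedPrime_iff] at hP
  obtain ⟨hp, m, rfl⟩ := hP
  refine ⟨m, ?_, fun r hr => by simpa [Submodule.mem_colon_singleton] using hle hr⟩
  rintro rfl
  exact hp.ne_top (by simp)

theorem not_isSMulRegular_of_mem_associatedPrime [IsNoetherianRing A]
    {P : Ideal A} (hP : P ∈ associatedPrimes A M) {x : A} (hx : x ∈ P) :
    ¬ IsSMulRegular M x := by
  have := biUnion_associatedPrimes_eq_compl_regular A M
  have h : x ∈ ⋃ p ∈ associatedPrimes A M, (p : Set A) := by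
    simp only [Set.mem_iUnion]
    exact ⟨P, hP, hx⟩
  rw [this] at h
  exact h

/-- The associated primes of `M × N` are those of `M` together with those of `N`, so prime avoidance
on the product treats both modules at once. -/
theorem exists_common_isSMulRegular [IsNoetherianRing A] [Module.Finite A M] [Module.Finite A N]
    (hM : ∃ x ∈ I, IsSMulRegular M x) (hN : ∃ x ∈ I, IsSMulRegular N x) :
    ∃ x ∈ I, IsSMulRegular M x ∧ IsSMulRegular N x := by
  by_contra! hcon
  have h : ∀ x ∈ I, ¬ IsSMulRegular (M × N) x := by
    intro x hx h
    refine hcon x hx (h.of_injective (LinearMap.inl A M N) LinearMap.inl_injective)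
      (h.of_injective (LinearMap.inr A M N) LinearMap.inr_injective)
  obtain ⟨P, hP, hle⟩ := exists_le_associatedPrime h
  rw [associatedPrimes.prod] at hP
  rcases hP with hP | hP
  · obtain ⟨x, hx, hr⟩ := hM
    exact not_isSMulRegular_of_mem_associatedPrime hP (hle hx) hr
  · obtain ⟨x, hx, hr⟩ := hN
    exact not_isSMulRegular_of_mem_associatedPrime hP (hle hx) hr

theorem isSMulRegular_quotSMulTop_iff {x y : A} :
    IsSMulRegular (QuotSMulTop x M) y ↔ ∀ m m' : M, y • m = x • m' → ∃ m'', m = x • m'' := by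
  rw [isSMulRegular_quotient_iff_mem_of_smul_mem]
  simp only [Submodule.mem_smul_pointwise_iff_exists, Submodule.mem_top, true_and]
  constructor
  · intro h m m' hm
    obtain ⟨m'', h'⟩ := h m ⟨m', hm.symm⟩
    exact ⟨m'', h'.symm⟩
  · rintro h m ⟨m', hm⟩
    obtain ⟨m'', h'⟩ := h m m' hm.symm
    exact ⟨m'', h'.symm⟩

theorem isSMulRegular_quotSMulTop_swap {x z : A} (hx : IsSMulRegular M x)
    (hz : IsSMulRegular (QuotSMulTop x M) z) : IsSMulRegular (QuotSMulTop z M) x := by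
  rw [isSMulRegular_quotSMulTop_iff] at hz ⊢
  intro m m' h
  obtain ⟨m'', rfl⟩ := hz m' m h.symm
  refine ⟨m'', hx ?_⟩
  simp only [h]
  rw [smul_comm]

/-- The quotients of `M` by `x` and `z` can be taken in either order. -/
noncomputable def quotSMulTopComm (x z : A) (M : Type*) [AddCommGroup M] [Module A M] :
    QuotSMulTop z (QuotSMulTop x M) ≃ₗ[A] QuotSMulTop x (QuotSMulTop z M) :=
  QuotSMulTop.congr z (QuotSMulTop.equivQuotTensor x M) ≪≫ₗ
    (QuotSMulTop.tensorQuotSMulTopEquivQuotSMulTop z (A ⧸ Ideal.span {x}) M).symm ≪≫ₗ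
    (QuotSMulTop.equivQuotTensor x (QuotSMulTop z M)).symm

/-- Otherwise some `m ∉ yM` is killed by `I` modulo `y`. Write `x m = y m'` and `z m = y m₁`.
Cancelling `y` gives `z m' = x m₁`, so `m' = x m''` by regularity of `z` modulo `x`, and cancelling
`x` gives `m = y m''`. -/
theorem exists_isSMulRegular_quotSMulTop [IsNoetherianRing A] [Module.Finite A M] {x y : A}
    (hx : IsSMulRegular M x) (hxI : x ∈ I) (hy : IsSMulRegular M y)
    (h : ∃ z ∈ I, IsSMulRegular (QuotSMulTop x M) z) :
    ∃ z ∈ I, IsSMulRegular (QuotSMulTop y M) z := by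
  by_contra! hcon
  obtain ⟨m, hm, hI⟩ := exists_annihilated_of_forall_not_isSMulRegular hcon
  obtain ⟨m, rfl⟩ := Submodule.mkQ_surjective _ m
  have key (r : A) (hr : r ∈ I) : ∃ m', r • m = y • m' := by
    have := hI r hr
    rw [← map_smul, Submodule.mkQ_apply, Submodule.Quotient.mk_eq_zero,
      Submodule.mem_smul_pointwise_iff_exists] at this
    obtain ⟨m', -, h⟩ := this
    exact ⟨m', h.symm⟩
  obtain ⟨m', hm'⟩ := key x hxI
  obtain ⟨z, hz, hzr⟩ := h
  rw [isSMulRegular_quotSMulTop_iff] at hzr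
  obtain ⟨m₁, h₁⟩ := key z hz
  obtain ⟨m'', h''⟩ := hzr m' m₁ (hy (by
    simp only
    rw [smul_comm, ← hm', smul_comm, h₁, smul_comm]))
  refine hm ?_
  rw [Submodule.mkQ_apply, Submodule.Quotient.mk_eq_zero,
      Submodule.mem_smul_pointwise_iff_exists]
  refine ⟨m'', trivial, hx ?_⟩
  simp only
  rw [hm', h'', smul_comm]

variable [IsNoetherianRing A]

/-- Dividing out any regular element drops the length of the longest regular sequence
by at most one. -/
theorem HasRegularSequence.quotSMulTop {n : ℕ} [Module.Finite A M]
    (h : HasRegularSequence I (n + 1) M)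
    {y : A} (hyI : y ∈ I) (hy : IsSMulRegular M y) : HasRegularSequence I n (QuotSMulTop y M) := by
  induction n generalizing M y with
  | zero => exact .zero
  | succ n ih =>
    obtain ⟨x, hxI, hx, hx'⟩ := HasRegularSequence.succ_iff.mp h
    have h1 : ∃ z ∈ I, IsSMulRegular (QuotSMulTop x M) z := by
      obtain ⟨z, hzI, hz, -⟩ := HasRegularSequence.succ_iff.mp hx'
      exact ⟨z, hzI, hz⟩
    -- An element `z` regular modulo both `x` and `y` links the two quotients: a long sequence on
    -- `M/x` gives one on `M/z` starting with `x`, and this in turn gives one on `M/y` starting with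
    -- `z`.
    obtain ⟨z, hzI, hzx, hzy⟩ := exists_common_isSMulRegular h1
      (exists_isSMulRegular_quotSMulTop hx hxI hy h1)
    have h2 : HasRegularSequence I (n + 1) (QuotSMulTop z M) :=
      HasRegularSequence.succ_iff.mpr ⟨x, hxI, isSMulRegular_quotSMulTop_swap hx hzx,
        (ih hx' hzI hzx).of_equiv (quotSMulTopComm x z M)⟩
    exact HasRegularSequence.succ_iff.mpr ⟨z, hzI, hzy,
      (ih h2 hyI (isSMulRegular_quotSMulTop_swap hy hzy)).of_equiv (quotSMulTopComm z y M)⟩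

/-- The depth lemma without Ext: divide by an element regular on both `F` and `N`. Regularity on `N`
keeps the sequence exact on the left. -/
theorem HasRegularSequence.kernel {n : ℕ} [Module.Finite A M] [Module.Finite A N]
    [Module.Finite A F] (f : M →ₗ[A] F) (g : F →ₗ[A] N) (hf : Function.Injective f)
    (hfg : Function.Exact f g) (hg : Function.Surjective g)
    (hF : HasRegularSequence I (n + 1) F) (hN : HasRegularSequence I n N) :
    HasRegularSequence I (n + 1) M := by
  induction n generalizing M F N with
  | zero =>
    obtain ⟨x, hxI, hx, -⟩ := HasRegularSequence.succ_iff.mp hF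
    exact HasRegularSequence.succ_iff.mpr ⟨x, hxI, hx.of_injective f hf, .zero⟩
  | succ n ih =>
    obtain ⟨z, hzI, hzF, hzN⟩ : ∃ z ∈ I, IsSMulRegular F z ∧ IsSMulRegular N z := by
      obtain ⟨x, hxI, hx, -⟩ := HasRegularSequence.succ_iff.mp hF
      obtain ⟨y, hyI, hy, -⟩ := HasRegularSequence.succ_iff.mp hN
      exact exists_common_isSMulRegular ⟨x, hxI, hx⟩ ⟨y, hyI, hy⟩
    refine HasRegularSequence.succ_iff.mpr ⟨z, hzI, hzF.of_injective f hf, ?_⟩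
    refine ih (QuotSMulTop.map z f) (QuotSMulTop.map z g) ?_ (QuotSMulTop.map_exact z hfg hg)
      (QuotSMulTop.map_surjective z hg) (hF.quotSMulTop hzI hzF) (hN.quotSMulTop hzI hzN)
    have := QuotSMulTop.map_first_exact_on_four_term_exact_of_isSMulRegular_last
      (r := z) (f₁ := (0 : PUnit.{1} →ₗ[A] M)) (f₂ := f) (f₃ := g)
      ((LinearMap.exact_zero_iff_injective _ f).mpr hf) hfg hzN
    rw [map_zero] at this
    exact (LinearMap.exact_zero_iff_injective _ _).mp this

end Regular

open IsLocalRing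
open scoped Pointwise

/-! ### Depth at a prime, expressed without fractions. -/

section Localization

variable {S : Type*} [CommRing S] (q : Ideal S) [q.IsPrime]

/-- The depth of the localization of `X` at the prime `q` is at least `n`. -/
def HasDepthAt (n : ℕ) (X : Type*) [AddCommGroup X] [Module S X] : Prop :=
  HasRegularSequence (maximalIdeal (Localization.AtPrime q)) n (LocalizedModule q.primeCompl X)

variable {X : Type*} [AddCommGroup X] [Module S X] {q}

theorem isSMulRegular_localizedModule_iff {x : S} :
    IsSMulRegular (LocalizedModule q.primeCompl X) (algebraMap S (Localization.AtPrime q) x) ↔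
      ∀ m : X, x • m = 0 → ∃ s ∉ q, s • m = 0 := by
  rw [isSMulRegular_iff_right_eq_zero_of_smul]
  constructor
  · intro h m hm
    have := h (LocalizedModule.mkLinearMap q.primeCompl X m) (by
      rw [algebraMap_smul, ← map_smul, hm, map_zero])
    obtain ⟨s, hs, h⟩ := LocalizedModule.mem_ker_mkLinearMap_iff.mp (LinearMap.mem_ker.mpr this)
    exact ⟨s, hs, h⟩
  · intro h y hy
    obtain ⟨⟨m, s⟩, rfl⟩ :=
      IsLocalizedModule.mk'_surjective q.primeCompl (LocalizedModule.mkLinearMap q.primeCompl X) y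
    simp only [Function.uncurry_apply_pair] at hy ⊢
    rw [algebraMap_smul, ← IsLocalizedModule.mk'_smul, IsLocalizedModule.mk'_eq_zero'] at hy
    obtain ⟨t, ht⟩ := hy
    obtain ⟨u, hu, h'⟩ := h (t.1 • m) (by rw [smul_comm]; exact ht)
    rw [IsLocalizedModule.mk'_eq_zero']
    refine ⟨⟨u, hu⟩ * t, ?_⟩
    rw [mul_smul]
    exact h'

/-- Localization commutes with dividing out multiples of an element. -/
noncomputable def localizedQuotSMulTopEquiv (x : S) (X : Type*) [AddCommGroup X] [Module S X] :
    QuotSMulTop (algebraMap S (Localization.AtPrime q) x) (LocalizedModule q.primeCompl X)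
      ≃ₗ[Localization.AtPrime q] LocalizedModule q.primeCompl (QuotSMulTop x X) :=
  QuotSMulTop.congr _ (LocalizedModule.equivTensorProduct q.primeCompl X) ≪≫ₗ
    QuotSMulTop.algebraMapTensorEquivTensorQuotSMulTop x X _ ≪≫ₗ
    (LocalizedModule.equivTensorProduct q.primeCompl (QuotSMulTop x X)).symm

/-- An isomorphism of modules induces an isomorphism of localizations. -/
noncomputable def localizedEquiv {Y : Type*} [AddCommGroup Y] [Module S Y] (e : X ≃ₗ[S] Y) :
    LocalizedModule q.primeCompl X ≃ₗ[Localization.AtPrime q] LocalizedModule q.primeCompl Y :=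
  IsLocalizedModule.mapEquiv q.primeCompl (LocalizedModule.mkLinearMap q.primeCompl X)
    (LocalizedModule.mkLinearMap q.primeCompl Y) (Localization.AtPrime q) e

theorem HasDepthAt.of_equiv {n : ℕ} {Y : Type*} [AddCommGroup Y] [Module S Y] (e : X ≃ₗ[S] Y)
    (h : HasDepthAt q n X) : HasDepthAt q n Y :=
  HasRegularSequence.of_equiv (localizedEquiv e) h

/-- Units do not affect regularity, so denominators can be cleared. This recursion allows depth at
`p` over `R` to be compared with depth at `q` over `S`, although the local rings differ. -/
theorem HasDepthAt.succ_iff {n : ℕ} : HasDepthAt q (n + 1) X ↔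
    ∃ x ∈ q, (∀ m : X, x • m = 0 → ∃ s ∉ q, s • m = 0) ∧ HasDepthAt q n (QuotSMulTop x X) := by
  unfold HasDepthAt
  rw [HasRegularSequence.succ_iff]
  constructor
  · rintro ⟨z, hz, hr, h⟩
    obtain ⟨x, s, rfl⟩ := IsLocalization.exists_mk'_eq q.primeCompl z
    have hu : IsUnit (algebraMap S (Localization.AtPrime q) s) :=
      IsLocalization.map_units (M := q.primeCompl) _ s
    have hx : algebraMap S (Localization.AtPrime q) x =
        algebraMap S (Localization.AtPrime q) s * IsLocalization.mk' _ x s := by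
      rw [mul_comm, IsLocalization.mk'_spec]
    refine ⟨x, (IsLocalization.AtPrime.mk'_mem_maximal_iff _ q x s).mp hz, ?_, ?_⟩
    · rw [← isSMulRegular_localizedModule_iff, hx]
      exact (hu.isSMulRegular _).mul hr
    · refine HasRegularSequence.of_equiv ?_ h
      refine Submodule.quotEquivOfEq _ _ ?_ ≪≫ₗ localizedQuotSMulTopEquiv x X
      rw [hx, mul_comm, mul_smul]
      congr 1
      refine le_antisymm (fun y _ => ?_) le_top
      obtain ⟨v, hv⟩ := hu
      rw [← hv]
      exact (Submodule.mem_smul_pointwise_iff_exists _ _ _).mpr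
        ⟨((v⁻¹ : (Localization.AtPrime q)ˣ) : Localization.AtPrime q) • y, trivial, by
          rw [smul_smul, Units.mul_inv, one_smul]⟩
  · rintro ⟨x, hx, hr, h⟩
    exact ⟨algebraMap S _ x, (IsLocalization.AtPrime.to_map_mem_maximal_iff _ q x).mpr hx,
      isSMulRegular_localizedModule_iff.mpr hr, h.of_equiv (localizedQuotSMulTopEquiv x X).symm⟩

theorem HasDepthAt.quotSMulTop {n : ℕ} [IsNoetherianRing S] [Module.Finite S X]
    (h : HasDepthAt q (n + 1) X) {x : S} (hx : x ∈ q)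
    (hr : ∀ m : X, x • m = 0 → ∃ s ∉ q, s • m = 0) : HasDepthAt q n (QuotSMulTop x X) :=
  (HasRegularSequence.quotSMulTop h
    ((IsLocalization.AtPrime.to_map_mem_maximal_iff _ q x).mpr hx)
    (isSMulRegular_localizedModule_iff.mpr hr)).of_equiv (localizedQuotSMulTopEquiv x X)

/-- If no such element existed, the maximal ideal of the localization would be associated to the
localized module, and its contraction `q` would be associated to `X`. -/
theorem exists_regular_of_notMem_associatedPrimes [IsNoetherianRing S] [Module.Finite S X]
    (h : q ∉ associatedPrimes S X) : ∃ x ∈ q, ∀ m : X, x • m = 0 → ∃ s ∉ q, s • m = 0 := by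
  by_contra! hcon
  have h1 : ∀ z ∈ maximalIdeal (Localization.AtPrime q),
      ¬ IsSMulRegular (LocalizedModule q.primeCompl X) z := by
    intro z hz hr
    obtain ⟨x, s, rfl⟩ := IsLocalization.exists_mk'_eq q.primeCompl z
    obtain ⟨m, hm, h2⟩ := hcon x ((IsLocalization.AtPrime.mk'_mem_maximal_iff _ q x s).mp hz)
    have hx : algebraMap S (Localization.AtPrime q) x =
        algebraMap S (Localization.AtPrime q) s * IsLocalization.mk' _ x s := by
      rw [mul_comm, IsLocalization.mk'_spec]
    have h3 := ((IsLocalization.map_units (M := q.primeCompl)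
      (Localization.AtPrime q) s).isSMulRegular _).mul hr
    rw [← hx, isSMulRegular_localizedModule_iff] at h3
    obtain ⟨t, ht, h4⟩ := h3 m hm
    exact h2 t ht h4
  obtain ⟨P, hP, hle⟩ := exists_le_associatedPrime h1
  have hPm : P = maximalIdeal (Localization.AtPrime q) :=
    (((maximalIdeal.isMaximal _).eq_of_le hP.isPrime.ne_top hle)).symm
  subst hPm
  open Module.associatedPrimes in
  have := preimage_comap_associatedPrimes_eq_associatedPrimes_of_isLocalizedModule q.primeCompl
    (Localization.AtPrime q) (LocalizedModule.mkLinearMap q.primeCompl X)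
  rw [← this] at hP
  refine h ?_
  have h5 := Localization.AtPrime.under_maximalIdeal (I := q)
  rw [Ideal.under_def] at h5
  rw [Set.mem_preimage, h5] at hP
  exact hP

theorem notMem_associatedPrimes_of_regular [IsNoetherianRing S] {q : Ideal S} {x : S} (hx : x ∈ q)
    (h : ∀ m : X, x • m = 0 → ∃ s ∉ q, s • m = 0) : q ∉ associatedPrimes S X := by
  rw [AssociatedPrimes.mem_iff, isAssociatedPrime_iff]
  rintro ⟨-, m, hm⟩
  have key (s : S) : s ∈ q ↔ s • m = 0 := by
    rw [hm, Submodule.mem_colon_singleton, Submodule.mem_bot]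
  obtain ⟨s, hs, h'⟩ := h m ((key x).mp hx)
  exact hs ((key s).mpr h')

theorem HasDepthAt.kernel {n : ℕ} [IsNoetherianRing S] {M N F : Type*} [AddCommGroup M]
    [AddCommGroup N] [AddCommGroup F] [Module S M] [Module S N] [Module S F] [Module.Finite S M]
    [Module.Finite S N] [Module.Finite S F] (f : M →ₗ[S] F) (g : F →ₗ[S] N)
    (hf : Function.Injective f) (hfg : Function.Exact f g) (hg : Function.Surjective g)
    (hF : HasDepthAt q (n + 1) F) (hN : HasDepthAt q n N) : HasDepthAt q (n + 1) M :=
  HasRegularSequence.kernel (LocalizedModule.map q.primeCompl f)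
    (LocalizedModule.map q.primeCompl g)
    (LocalizedModule.map_injective _ f hf) (LocalizedModule.map_exact _ f g hfg)
    (LocalizedModule.map_surjective _ g hg) hF hN

theorem isMCM_iff [IsNoetherianRing S] : IsMCM S X ↔
    ∀ (q : Ideal S) [q.IsPrime] (n : ℕ), q.height = n → HasDepthAt q n X := by
  constructor
  · intro h q _ n hn
    exact (le_depth_iff _ n).mp (hn ▸ h q)
  · intro h q _
    have := Ideal.finiteHeight_of_isNoetherianRing q
    obtain ⟨n, hn⟩ := ENat.ne_top_iff_exists.mp (Ideal.height_ne_top (I := q) ‹q.IsPrime›.ne_top)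
    rw [← hn]
    exact (le_depth_iff _ n).mpr (h q n hn.symm)

theorem IsCohenMacaulay.hasDepthAt [IsNoetherianRing S] (h : IsCohenMacaulay S) {n : ℕ}
    (hn : q.height = n) [Module.Free S X] : HasDepthAt q n X := by
  have h1 : HasRegularSequence (maximalIdeal (Localization.AtPrime q)) n (Localization.AtPrime q) :=
    (le_depth_iff _ n).mp (by rw [h q, hn])
  exact HasRegularSequence.of_flat h1

end Localization

/-! ### Depth and maximal Cohen–Macaulay modules along a finite extension. -/

section Extension

variable {R S : Type u} [CommRing R] [CommRing S] [Algebra R S]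
variable {X : Type*} [AddCommGroup X] [Module R X] [Module S X] [IsScalarTower R S X]

/-- If `p` is the annihilator of `y` in `R`, the annihilator of `S y` contracts to `p`. Take a prime
over `p` containing it and shrink to a minimal prime of it: this is associated, and its contraction
is squeezed to `p`. -/
theorem exists_mem_associatedPrimes_comap_eq [IsNoetherianRing R] [IsNoetherianRing S]
    [Algebra.IsIntegral R S] {p : Ideal R} (hp : p ∈ associatedPrimes R X) :
    ∃ q ∈ associatedPrimes S X, q.comap (algebraMap R S) = p := by
  rw [AssociatedPrimes.mem_iff, isAssociatedPrime_iff] at hp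
  obtain ⟨hp, y, hy⟩ := hp
  let Y : Submodule S X := Submodule.span S {y}
  have hJ (r : R) : algebraMap R S r ∈ Module.annihilator S Y ↔ r ∈ p := by
    rw [hy, Submodule.mem_colon_singleton, Submodule.mem_bot]
    change _ ∈ (Submodule.span S {y}).annihilator ↔ _
    rw [Submodule.mem_annihilator_span_singleton, algebraMap_smul]
  obtain ⟨q, hq, hqp, hqc⟩ := Ideal.exists_ideal_over_prime_of_isIntegral p
    (Module.annihilator S Y) (fun r hr => (hJ r).mp hr)
  obtain ⟨q', hq', hle⟩ := Ideal.exists_minimalPrimes_le hq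
  refine ⟨q', associatedPrimes.subset_of_injective Y.subtype_injective
    (Module.associatedPrimes.minimalPrimes_annihilator_subset_associatedPrimes S Y hq'), ?_⟩
  refine le_antisymm (hqc ▸ Ideal.comap_mono hle) fun r hr => ?_
  exact hq'.1.2 ((hJ r).mpr hr)

/-- Dividing an `S`-module by multiples of an element of `R` over either ring. -/
noncomputable def quotSMulTopRestrictEquiv (x : R) (X : Type*) [AddCommGroup X] [Module R X]
    [Module S X] [IsScalarTower R S X] :
    QuotSMulTop (algebraMap R S x) X ≃ₗ[R] QuotSMulTop x X :=
  (Submodule.Quotient.restrictScalarsEquiv R (algebraMap R S x • (⊤ : Submodule S X))).symm ≪≫ₗ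
    Submodule.quotEquivOfEq _ _ (by
      ext y
      simp [Submodule.mem_smul_pointwise_iff_exists])

theorem regular_of_regular_comap {p : Ideal R} {q : Ideal S} [q.IsPrime]
    (hq : q.comap (algebraMap R S) = p) {x : R} (h : ∀ m : X, x • m = 0 → ∃ s ∉ p, s • m = 0)
    (m : X) (hm : algebraMap R S x • m = 0) : ∃ s ∉ q, s • m = 0 := by
  obtain ⟨s, hs, h'⟩ := h m (by rwa [algebraMap_smul] at hm)
  exact ⟨algebraMap R S s, fun h => hs (hq ▸ h), by rwa [algebraMap_smul]⟩

theorem HasDepthAt.of_restrictScalars {n : ℕ} {p : Ideal R} [p.IsPrime] {q : Ideal S} [q.IsPrime]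
    (hq : q.comap (algebraMap R S) = p) (h : HasDepthAt p n X) : HasDepthAt q n X := by
  induction n generalizing X with
  | zero => exact HasRegularSequence.zero
  | succ n ih =>
    obtain ⟨x, hx, hr, h⟩ := HasDepthAt.succ_iff.mp h
    refine HasDepthAt.succ_iff.mpr ⟨algebraMap R S x, ?_, regular_of_regular_comap hq hr, ?_⟩
    · rw [← hq] at hx
      exact hx
    · exact ih (h.of_equiv (quotSMulTopRestrictEquiv x X).symm)

/-- Positive depth at all primes over `p` excludes `p` from the associated primes over `R`. The
resulting element of `p`, regular at `p`, is regular at every prime above, so one can divide by it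
and induct. -/
theorem HasDepthAt.restrictScalars [IsNoetherianRing R] [IsNoetherianRing S]
    [Module.Finite R S] [Module.Finite S X]
    {n : ℕ} {p : Ideal R} [p.IsPrime]
    (h : ∀ (q : Ideal S) [q.IsPrime], q.comap (algebraMap R S) = p → HasDepthAt q n X) :
    HasDepthAt p n X := by
  induction n generalizing X with
  | zero => exact HasRegularSequence.zero
  | succ n ih =>
    have : Module.Finite R X := Module.Finite.trans S X
    have hp : p ∉ associatedPrimes R X := by
      intro hp
      obtain ⟨q, hq, hqc⟩ := exists_mem_associatedPrimes_comap_eq (S := S) hp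
      have := hq.isPrime
      obtain ⟨x, hx, hr, -⟩ := HasDepthAt.succ_iff.mp (h q hqc)
      exact notMem_associatedPrimes_of_regular hx hr hq
    obtain ⟨x, hx, hr⟩ := exists_regular_of_notMem_associatedPrimes hp
    refine HasDepthAt.succ_iff.mpr ⟨x, hx, hr, ?_⟩
    refine (ih fun q _ hq => ?_).of_equiv (quotSMulTopRestrictEquiv (S := S) x X)
    refine (h q hq).quotSMulTop ?_ (regular_of_regular_comap hq hr)
    rw [← hq] at hx
    exact hx

/-- Heights do not drop under contraction along an integral extension, so the depth available at the
contraction suffices. Under condition 2 this applies to `Hom_R(S, R)`. -/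
theorem IsMCM.of_restrictScalars [IsNoetherianRing R] [IsNoetherianRing S]
    [Module.Finite R S] (h : IsMCM R X) : IsMCM S X := by
  rw [isMCM_iff] at h ⊢
  intro q _ n hn
  have hle := height_le_height_comap R S q
  have := Ideal.finiteHeight_of_isNoetherianRing (q.comap (algebraMap R S))
  obtain ⟨m, hm⟩ := ENat.ne_top_iff_exists.mp (Ideal.height_ne_top
    (I := q.comap (algebraMap R S)) (Ideal.IsPrime.ne_top inferInstance))
  have h1 := (h _ m hm.symm).of_restrictScalars (q := q) rfl
  rw [hn, ← hm] at hle
  exact HasRegularSequence.mono (by exact_mod_cast hle) h1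

/-- Incomparability gives one inequality; the other is going down, which uses that `R` is normal. -/
theorem height_eq_height_comap [IsNoetherianRing R] [IsNoetherianRing S]
    [Module.Finite R S] [IsDomain S] [FaithfulSMul R S]
    [IsIntegrallyClosed R] (q : Ideal S) [q.IsPrime] :
    q.height = (q.comap (algebraMap R S)).height := by
  refine le_antisymm (height_le_height_comap R S q) ?_
  have : q.LiesOver (q.comap (algebraMap R S)) := ⟨rfl⟩
  rw [Ideal.height_eq_height_add_of_liesOver_of_hasGoingDown (q.comap (algebraMap R S)) q]
  exact le_self_add

theorem IsMCM.restrictScalars [IsNoetherianRing R] [IsNoetherianRing S]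
    [Module.Finite R S] [Module.Finite S X] [IsDomain S]
    [FaithfulSMul R S] [IsIntegrallyClosed R] (h : IsMCM S X) : IsMCM R X := by
  rw [isMCM_iff] at h ⊢
  intro p _ n hn
  exact HasDepthAt.restrictScalars fun q _ hq =>
    h q n (by rw [height_eq_height_comap (R := R) q, hq, hn])

end Extension

/-! ### Calculus of classes in `H(R)` and `H(R)_ℝ`. -/

section Classes

variable (R : Type u) [CommRing R]

/-- The class in `H(R)` of an unbundled finitely generated module. -/
noncomputable def cls (M : Type u) [AddCommGroup M] [Module R M] [Module.Finite R M] : H R :=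
  hClass R (FGModuleCat.of R M)

/-- The canonical map `H(R) → H(R)_ℝ`. -/
noncomputable def toReal : H R →+ HReal R where
  toFun x := TensorProduct.tmul ℤ 1 x
  map_zero' := TensorProduct.tmul_zero _ _
  map_add' := TensorProduct.tmul_add _

variable {R}
variable {M N F : Type u} [AddCommGroup M] [Module R M] [Module.Finite R M]
  [AddCommGroup N] [Module R N] [Module.Finite R N] [AddCommGroup F] [Module R F]
  [Module.Finite R F]

theorem toReal_cls : toReal R (cls R M) = realClass R M := rfl

theorem cls_eq_add (f : M →ₗ[R] F) (g : F →ₗ[R] N) (hf : Function.Injective f)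
    (hfg : Function.Exact f g) (hg : Function.Surjective g) :
    cls R F = cls R M + cls R N := by
  unfold cls hClass gClass
  rw [← map_add, ← map_add]
  congr 1
  rw [QuotientAddGroup.mk'_apply, QuotientAddGroup.mk'_apply]
  refine (QuotientAddGroup.eq.mpr ?_).symm
  refine AddSubgroup.subset_closure ⟨FGModuleCat.of R M, FGModuleCat.of R F, FGModuleCat.of R N,
    f, g, hf, hfg, hg, ?_⟩
  abel

theorem cls_eq_zero_of_isPseudoZero (h : IsPseudoZero R M) : cls R M = 0 :=
  (QuotientAddGroup.eq_zero_iff _).mpr (AddSubgroup.subset_closure ⟨FGModuleCat.of R M, h, rfl⟩)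

theorem isPseudoZero_of_forall {M : Type*} [AddCommGroup M] [Module R M]
    (h : ∀ (p : Ideal R) [p.IsPrime], p.height ≤ 1 →
    ∀ m : M, ∃ s ∉ p, s • m = 0) : IsPseudoZero R M := by
  intro p _ hp
  rw [LocalizedModule.subsingleton_iff]
  intro m
  obtain ⟨s, hs, h⟩ := h p hp m
  exact ⟨s, hs, h⟩

theorem cls_eq_zero_of_forall (h : ∀ (p : Ideal R) [p.IsPrime], p.height ≤ 1 →
    ∀ m : M, ∃ s ∉ p, s • m = 0) : cls R M = 0 :=
  cls_eq_zero_of_isPseudoZero (isPseudoZero_of_forall h)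

theorem cls_eq_zero_of_subsingleton [Subsingleton M] : cls R M = 0 :=
  cls_eq_zero_of_forall fun p _ _ m =>
    ⟨1, (Ideal.ne_top_iff_one p).mp ‹p.IsPrime›.ne_top, Subsingleton.elim _ _⟩

theorem cls_congr (e : M ≃ₗ[R] N) : cls R M = cls R N := by
  have := cls_eq_add (R := R) (M := M) (F := N) (N := PUnit) e.toLinearMap 0 e.injective
    ((e.toLinearMap.exact_zero_iff_surjective _).mpr e.surjective)
    (Function.surjective_to_subsingleton _)
  rw [this, cls_eq_zero_of_subsingleton (M := PUnit), add_zero]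

theorem cls_prod : cls R (M × N) = cls R M + cls R N :=
  cls_eq_add (LinearMap.inl R M N) (LinearMap.snd R M N) LinearMap.inl_injective
    Function.Exact.inl_snd LinearMap.snd_surjective

theorem cls_pi (n : ℕ) : cls R (Fin n → R) = n • cls R R := by
  induction n with
  | zero => rw [cls_eq_zero_of_subsingleton, zero_nsmul]
  | succ n ih =>
    rw [← cls_congr (Fin.consLinearEquiv R fun _ : Fin (n + 1) => R), cls_prod, ih, add_smul,
      one_smul, add_comm]

theorem realClass_congr (e : M ≃ₗ[R] N) : realClass R M = realClass R N := by
  rw [← toReal_cls, ← toReal_cls, cls_congr e]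

theorem realClass_prod : realClass R (M × N) = realClass R M + realClass R N := by
  rw [← toReal_cls, cls_prod, map_add, toReal_cls, toReal_cls]

theorem realClass_eq_add (f : M →ₗ[R] F) (g : F →ₗ[R] N) (hf : Function.Injective f)
    (hfg : Function.Exact f g) (hg : Function.Surjective g) :
    realClass R F = realClass R M + realClass R N := by
  rw [← toReal_cls, cls_eq_add f g hf hfg hg, map_add, toReal_cls, toReal_cls]

theorem realClass_eq_zero_of_subsingleton [Subsingleton M] : realClass R M = 0 := by
  rw [← toReal_cls, cls_eq_zero_of_subsingleton, map_zero]

/-- The classes of modules span `H(R)_ℝ`. -/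
theorem mem_of_forall_realClass_mem (W : Submodule ℝ (HReal R))
    (h : ∀ X : FGModuleCat.{u} R, realClass R X ∈ W) (w : HReal R) : w ∈ W := by
  induction w using TensorProduct.induction_on with
  | zero => exact W.zero_mem
  | add x y hx hy => exact W.add_mem hx hy
  | tmul r x =>
    have h1 : toReal R x ∈ W := by
      obtain ⟨x, rfl⟩ := QuotientAddGroup.mk'_surjective _ x
      obtain ⟨x, rfl⟩ := QuotientAddGroup.mk'_surjective _ x
      induction x using FreeAbelianGroup.induction_on with
      | zero => simp only [map_zero]; exact W.zero_mem
      | of X => exact h X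
      | neg X hX => simp only [map_neg]; exact W.neg_mem hX
      | add x y hx hy => simp only [map_add]; exact W.add_mem hx hy
    have h2 : TensorProduct.tmul ℤ r x = r • toReal R x := by
      change _ = r • TensorProduct.tmul ℤ (1 : ℝ) x
      rw [TensorProduct.smul_tmul', smul_eq_mul, mul_one]
    rw [h2]
    exact W.smul_mem r h1

end Classes

/-! ### Restriction of scalars and its surjectivity. -/

section Restriction

variable (R S : Type u) [CommRing R] [CommRing S] [Algebra R S] [Module.Finite R S]
variable (X : Type u) [AddCommGroup X] [Module R X] [Module S X] [IsScalarTower R S X]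
  [Module.Finite S X] [Module.Finite R X]

/-- Restriction of scalars does not change the underlying module of an `S`-module which already
carries a compatible `R`-module structure. -/
def restrictObjEquiv : restrictObj R S (FGModuleCat.of S X) ≃ₗ[R] X where
  toFun x := x
  invFun x := x
  map_add' _ _ := rfl
  map_smul' r x := algebraMap_smul S r (show X from x)
  left_inv _ := rfl
  right_inv _ := rfl

theorem realRestrict_realClass : realRestrict R S (realClass S X) = realClass R X := by
  have h : hRestrict R S (hClass S (FGModuleCat.of S X)) =
      hClass R (restrictObj R S (FGModuleCat.of S X)) := by
    simp [hRestrict, hClass, gRestrict, gClass]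
  refine Eq.trans ?_ (realClass_congr (restrictObjEquiv R S X))
  unfold realRestrict realClass
  rw [LinearMap.baseChange_tmul]
  exact congrArg _ h

end Restriction

section Surjective

variable {R : Type u} [CommRing R] [IsNoetherianRing R]

theorem realClass_mem_of_forall_prime (W : Submodule ℝ (HReal R))
    (h : ∀ (p : Ideal R) [p.IsPrime], realClass R (R ⧸ p) ∈ W)
    (M : Type u) [AddCommGroup M] [Module R M] (hM : Module.Finite R M) : realClass R M ∈ W := by
  induction hM using IsNoetherianRing.induction_on_isQuotientEquivQuotientPrime R with
  | subsingleton N => rw [realClass_eq_zero_of_subsingleton]; exact W.zero_mem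
  | quotient N p e =>
    have := p.2
    rw [realClass_congr e]
    exact h p.1
  | exact N₁ N₂ N₃ f g hf hg hfg h₁ h₃ =>
    rw [realClass_eq_add f g hf hfg hg]
    exact W.add_mem h₁ h₃

/-- In a prime filtration of `M` the factors are `R/p` or `R/p'` with `p < p'`, and the latter
vanish modulo `W`. The number `k` counts the copies of `R/p`; if there are none, `M` vanishes at
`p`. -/
theorem exists_realClass_sub_mem (W : Submodule ℝ (HReal R)) (p : Ideal R) [p.IsPrime]
    (h : ∀ (p' : Ideal R) [p'.IsPrime], p < p' → realClass R (R ⧸ p') ∈ W)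
    (M : Type u) [AddCommGroup M] [Module R M] (hM : Module.Finite R M)
    (hpM : ∀ r ∈ p, ∀ m : M, r • m = 0) :
    ∃ k : ℕ, realClass R M - k • realClass R (R ⧸ p) ∈ W ∧
      (k = 0 → ∀ m : M, ∃ s ∉ p, s • m = 0) := by
  have hp1 : (1 : R) ∉ p := (Ideal.ne_top_iff_one p).mp ‹p.IsPrime›.ne_top
  induction hM using IsNoetherianRing.induction_on_isQuotientEquivQuotientPrime R with
  | subsingleton N =>
    refine ⟨0, ?_, fun _ m => ⟨1, hp1, Subsingleton.elim _ _⟩⟩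
    rw [realClass_eq_zero_of_subsingleton, zero_smul, sub_zero]
    exact W.zero_mem
  | quotient N p' e =>
    have := p'.2
    have hle : p ≤ p'.1 := by
      intro r hr
      have h1 := hpM r hr (e.symm 1)
      rw [← map_smul, LinearEquiv.map_eq_zero_iff, Algebra.smul_def, mul_one,
        Ideal.Quotient.algebraMap_eq, Ideal.Quotient.eq_zero_iff_mem] at h1
      exact h1
    rcases hle.eq_or_lt with heq | hlt
    · refine ⟨1, ?_, by simp⟩
      rw [one_smul, realClass_congr (e ≪≫ₗ Submodule.quotEquivOfEq _ _ heq.symm), sub_self]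
      exact W.zero_mem
    · refine ⟨0, ?_, fun _ m => ?_⟩
      · rw [zero_smul, sub_zero, realClass_congr e]
        exact h p'.1 hlt
      · obtain ⟨s, hs, hsp⟩ := SetLike.exists_of_lt hlt
        refine ⟨s, hsp, e.injective ?_⟩
        obtain ⟨x, hx⟩ := Ideal.Quotient.mk_surjective (e m)
        rw [map_smul, map_zero, ← hx, Algebra.smul_def, Ideal.Quotient.algebraMap_eq, ← map_mul,
          Ideal.Quotient.eq_zero_iff_mem]
        exact Ideal.mul_mem_right _ _ hs
  | exact N₁ N₂ N₃ f g hf hg hfg h₁ h₃ =>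
    obtain ⟨k₁, hk₁, h₁⟩ := h₁ (fun r hr m => hf (by rw [map_smul, map_zero, hpM r hr]))
    obtain ⟨k₃, hk₃, h₃⟩ := h₃ (fun r hr m => by
      obtain ⟨m, rfl⟩ := hg m
      rw [← map_smul, hpM r hr, map_zero])
    refine ⟨k₁ + k₃, ?_, fun hk m => ?_⟩
    · rw [realClass_eq_add f g hf hfg hg, add_smul]
      convert W.add_mem hk₁ hk₃ using 1
      abel
    · obtain ⟨s, hs, hsm⟩ := h₃ (by omega) (g m)
      rw [← map_smul] at hsm
      obtain ⟨y, hy⟩ := (hfg _).mp hsm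
      obtain ⟨t, ht, hty⟩ := h₁ (by omega) y
      refine ⟨t * s, fun hts => ?_, ?_⟩
      · exact (‹p.IsPrime›.mem_or_mem hts).elim ht hs
      · rw [mul_smul, ← hy, ← map_smul, hty, map_zero]

/-- For `q` over `p`, `[S/q]` is `k [R/p]` plus classes from strictly larger primes, which are in
the range by induction. Here `k ≠ 0` because `S/q` does not vanish at `p`, and real coefficients
allow division by `k`. -/
theorem realRestrict_surjective (R S : Type u) [CommRing R] [CommRing S] [Algebra R S]
    [IsNoetherianRing R] [FaithfulSMul R S] [Module.Finite R S] :
    Function.Surjective (realRestrict R S) := by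
  rw [← LinearMap.range_eq_top]
  set W := LinearMap.range (realRestrict R S) with hW
  have key : ∀ (p : Ideal R), p.IsPrime → realClass R (R ⧸ p) ∈ W := by
    intro p
    induction p using WellFoundedGT.induction with
    | ind p ih =>
      intro hp
      obtain ⟨q, -, hq, hqc⟩ := Ideal.exists_ideal_over_prime_of_isIntegral p (⊥ : Ideal S) (by
        rw [← RingHom.ker_eq_comap_bot,
          (RingHom.injective_iff_ker_eq_bot _).mp (FaithfulSMul.algebraMap_injective R S)]
        exact bot_le)
      have hmem (r : R) : (algebraMap R S r) ∈ q ↔ r ∈ p := by rw [← hqc]; rfl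
      have h1 (r : R) (s : S) : r • (Ideal.Quotient.mk q s) = Ideal.Quotient.mk q (r • s) := rfl
      obtain ⟨k, hk, hk0⟩ := exists_realClass_sub_mem W p (fun p' hp' hlt => ih p' hlt hp')
        (S ⧸ q) inferInstance (fun r hr m => by
          obtain ⟨m, rfl⟩ := Ideal.Quotient.mk_surjective m
          rw [h1, Algebra.smul_def, Ideal.Quotient.eq_zero_iff_mem]
          exact Ideal.mul_mem_right _ _ ((hmem r).mpr hr))
      have hk0 : k ≠ 0 := by
        intro h
        obtain ⟨s, hs, h2⟩ := hk0 h (Ideal.Quotient.mk q 1)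
        rw [h1, Algebra.smul_def, mul_one, Ideal.Quotient.eq_zero_iff_mem, hmem] at h2
        exact hs h2
      have h3 : realClass R (S ⧸ q) ∈ W := ⟨realClass S (S ⧸ q), realRestrict_realClass R S _⟩
      have h4 : (k : ℝ) • realClass R (R ⧸ p) ∈ W := by
        have := W.sub_mem h3 hk
        rw [sub_sub_cancel] at this
        rwa [Nat.cast_smul_eq_nsmul]
      have h5 := W.smul_mem ((k : ℝ)⁻¹) h4
      rwa [smul_smul, inv_mul_cancel₀ (by exact_mod_cast hk0), one_smul] at h5
  rw [eq_top_iff]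
  rintro w -
  exact mem_of_forall_realClass_mem W
    (fun X => realClass_mem_of_forall_prime W (fun p _ => key p ‹_›) X inferInstance) w

end Surjective

/-! ### Normal domains at primes of height one. -/

section HeightOne

variable {R : Type u} [CommRing R]

theorem eq_of_le_of_height_eq_one [IsNoetherianRing R] {p p' : Ideal R} [p.IsPrime]
    [p'.IsPrime] (hle : p ≤ p')
    (hp : p.height = 1) (hp' : p'.height ≤ 1) : p = p' := by
  have := Ideal.finiteHeight_of_isNoetherianRing p
  exact Ideal.eq_of_le_of_height_le _ hle (hp'.trans hp.ge)

theorem height_eq_one_of_ne_bot [IsDomain R] {p : Ideal R} (hp : p ≠ ⊥) (h : p.height ≤ 1) :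
    p.height = 1 := by
  refine le_antisymm h (Order.one_le_iff_ne_zero.mpr fun h0 => hp ?_)
  exact Ideal.height_eq_zero_iff_eq_bot.mp h0

theorem isPrincipalIdealRing_localization [IsDomain R] [IsNoetherianRing R]
    [IsIntegrallyClosed R] {p : Ideal R} [p.IsPrime]
    (hp : p.height = 1) : IsPrincipalIdealRing (Localization.AtPrime p) := by
  have htfae := tfae_of_isNoetherianRing_of_isLocalRing_of_isDomain (Localization.AtPrime p)
  refine (htfae.out 0 3 :).mpr
    ⟨isIntegrallyClosed_of_isLocalization _ p.primeCompl p.primeCompl_le_nonZeroDivisors,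
      fun P hP _ => ?_⟩
  have h1 : P.under R ≤ p := by
    have := Ideal.comap_mono (f := algebraMap R (Localization.AtPrime p))
      (le_maximalIdeal_of_isPrime P)
    exact this.trans_eq Localization.AtPrime.under_maximalIdeal
  have h2 : P.under R ≠ ⊥ := by
    intro h
    apply hP
    rw [← IsLocalization.map_under p.primeCompl (Localization.AtPrime p) P, h, Ideal.map_bot]
  have h3 : P.under R = p := eq_of_le_of_height_eq_one h1
    (height_eq_one_of_ne_bot h2 ((Ideal.height_mono h1).trans hp.le)) hp.le
  rw [← IsLocalization.map_under p.primeCompl (Localization.AtPrime p) P, h3]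
  exact Localization.AtPrime.map_eq_maximalIdeal

variable (R) in
/-- The torsion of `M` is not supported at primes of height one. -/
def IsTorsionFreeInCodimOne (M : Type*) [AddCommGroup M] [Module R M] : Prop :=
  ∀ (p : Ideal R) [p.IsPrime], p.height = 1 → ∀ (r : R) (m : M), r ≠ 0 → r • m = 0 →
    ∃ s ∉ p, s • m = 0

variable {M N : Type*} [AddCommGroup M] [Module R M] [AddCommGroup N] [Module R N]

theorem IsTorsionFreeInCodimOne.of_injective (h : IsTorsionFreeInCodimOne R N) (f : M →ₗ[R] N)
    (hf : Function.Injective f) : IsTorsionFreeInCodimOne R M := by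
  intro p _ hp r m hr hrm
  obtain ⟨s, hs, h'⟩ := h p hp r (f m) hr (by rw [← map_smul, hrm, map_zero])
  exact ⟨s, hs, hf (by rw [map_smul, h', map_zero])⟩

theorem IsLocallyFreeInCodimOne.isTorsionFreeInCodimOne [IsDomain R]
    (h : IsLocallyFreeInCodimOne R M) :
    IsTorsionFreeInCodimOne R M := by
  intro p _ hp r m hr hrm
  have := h p hp
  have h1 : algebraMap R (Localization.AtPrime p) r •
      LocalizedModule.mkLinearMap p.primeCompl M m = 0 := by
    rw [algebraMap_smul, ← map_smul, hrm, map_zero]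
  have h2 := (Module.isTorsionFree_iff_smul_eq_zero (R := Localization.AtPrime p)).mp
    inferInstance _ _ h1
  rcases h2 with h2 | h2
  · have := IsLocalization.injective (Localization.AtPrime p) p.primeCompl_le_nonZeroDivisors
    exact absurd (this (h2.trans (map_zero _).symm)) hr
  · obtain ⟨s, hs, h3⟩ := LocalizedModule.mem_ker_mkLinearMap_iff.mp (LinearMap.mem_ker.mpr h2)
    exact ⟨s, hs, h3⟩

theorem IsTorsionFreeInCodimOne.isTorsionFree_localizedModule [IsDomain R]
    (h : IsTorsionFreeInCodimOne R M)
    {p : Ideal R} [p.IsPrime] (hp : p.height = 1) :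
    Module.IsTorsionFree (Localization.AtPrime p) (LocalizedModule p.primeCompl M) := by
  rw [Module.isTorsionFree_iff_smul_eq_zero]
  intro z y hzy
  rw [or_iff_not_imp_left]
  intro hz
  obtain ⟨r, s, rfl⟩ := IsLocalization.exists_mk'_eq p.primeCompl z
  obtain ⟨⟨m, t⟩, rfl⟩ :=
    IsLocalizedModule.mk'_surjective p.primeCompl (LocalizedModule.mkLinearMap p.primeCompl M) y
  simp only [Function.uncurry_apply_pair] at hzy ⊢
  rw [IsLocalizedModule.mk'_smul_mk', IsLocalizedModule.mk'_eq_zero'] at hzy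
  obtain ⟨v, hv⟩ := hzy
  have hr : r ≠ 0 := by
    rintro rfl
    exact hz (IsLocalization.mk'_zero _)
  have hv0 : v.1 ≠ 0 := fun h0 => v.2 (h0 ▸ p.zero_mem)
  obtain ⟨w, hw, h'⟩ := h p hp (v.1 * r) m (mul_ne_zero hv0 hr) (by
    rw [mul_smul]; exact hv)
  rw [IsLocalizedModule.mk'_eq_zero']
  exact ⟨⟨w, hw⟩, h'⟩

theorem IsTorsionFreeInCodimOne.isLocallyFreeInCodimOne [IsDomain R]
    [IsNoetherianRing R] [IsIntegrallyClosed R] [Module.Finite R M]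
    (h : IsTorsionFreeInCodimOne R M) : IsLocallyFreeInCodimOne R M := by
  intro p _ hp
  have := isPrincipalIdealRing_localization hp
  have := h.isTorsionFree_localizedModule hp
  infer_instance

/-- A uniformizer at a prime of height one which lies in the ring itself. -/
theorem exists_uniformizer [IsDomain R] [IsNoetherianRing R] [IsIntegrallyClosed R]
    {p : Ideal R} [p.IsPrime] (hp : p.height = 1) :
    ∃ x ∈ p, x ≠ 0 ∧ maximalIdeal (Localization.AtPrime p) =
      Ideal.span {algebraMap R (Localization.AtPrime p) x} := by
  have := isPrincipalIdealRing_localization hp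
  obtain ⟨z, hz⟩ := IsPrincipalIdealRing.principal (maximalIdeal (Localization.AtPrime p))
  obtain ⟨x, s, rfl⟩ := IsLocalization.exists_mk'_eq p.primeCompl z
  have hspan : maximalIdeal (Localization.AtPrime p) =
      Ideal.span {algebraMap R (Localization.AtPrime p) x} := by
    rw [hz, ← IsLocalization.mk'_spec (Localization.AtPrime p) x s,
      Ideal.span_singleton_mul_right_unit (IsLocalization.map_units _ s)]
  refine ⟨x, ?_, ?_, hspan⟩
  · rw [← IsLocalization.AtPrime.to_map_mem_maximal_iff (Localization.AtPrime p) p x, hspan]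
    exact Ideal.mem_span_singleton_self _
  · rintro rfl
    rw [map_zero, Ideal.span_singleton_zero] at hspan
    have h1 := Localization.AtPrime.under_maximalIdeal (I := p)
    rw [hspan, Ideal.under_def, ← RingHom.ker_eq_comap_bot, (RingHom.injective_iff_ker_eq_bot _).mp
      (IsLocalization.injective (Localization.AtPrime p) p.primeCompl_le_nonZeroDivisors)] at h1
    rw [← h1, Ideal.height_bot] at hp
    exact zero_ne_one hp

/-- At a prime of height one, an element of a torsion-free module that is not locally a multiple
of the uniformizer is detected by a linear form. -/
theorem IsTorsionFreeInCodimOne.exists_dual_notMem [IsDomain R] [IsNoetherianRing R]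
    [IsIntegrallyClosed R] [Module.Finite R M]
    (h : IsTorsionFreeInCodimOne R M) {p : Ideal R} [p.IsPrime] (hp : p.height = 1) {x : R}
    (hx : maximalIdeal (Localization.AtPrime p) =
      Ideal.span {algebraMap R (Localization.AtPrime p) x}) (a : M)
    (ha : ∀ s ∉ p, ∀ b : M, s • a ≠ x • b) : ∃ φ : M →ₗ[R] R, φ a ∉ p := by
  have := h.isLocallyFreeInCodimOne p hp
  let b := Module.Free.chooseBasis (Localization.AtPrime p) (LocalizedModule p.primeCompl M)
  let f := LocalizedModule.mkLinearMap p.primeCompl M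
  -- If all coordinates of `a` were divisible by `x`, then so would be `a` locally, against `ha`
  -- once denominators are cleared.
  obtain ⟨i, hi⟩ : ∃ i, b.repr (f a) i ∉ maximalIdeal (Localization.AtPrime p) := by
    by_contra! hcon
    have h1 (i) : ∃ c, b.repr (f a) i = algebraMap R (Localization.AtPrime p) x * c := by
      have := hcon i
      rw [hx, Ideal.mem_span_singleton] at this
      exact this
    choose c hc using h1
    have h2 : f a = x • ∑ i, c i • b i := by
      rw [← b.sum_repr (f a), Finset.smul_sum]
      refine Finset.sum_congr rfl fun i _ => ?_
      rw [hc i, mul_smul, algebraMap_smul]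
    obtain ⟨⟨m, t⟩, hmt⟩ := IsLocalizedModule.mk'_surjective p.primeCompl f (∑ i, c i • b i)
    rw [← hmt, Function.uncurry_apply_pair, ← IsLocalizedModule.mk'_smul, eq_comm,
      IsLocalizedModule.mk'_eq_iff, ← LinearMap.map_smul_of_tower] at h2
    obtain ⟨s, hs⟩ := IsLocalizedModule.exists_of_eq (S := p.primeCompl) (f := f) h2
    refine ha (s * t : p.primeCompl) (s * t).2 (s.1 • m) ?_
    rw [smul_comm x, Submonoid.coe_mul, mul_smul]
    exact hs.symm
  -- The coordinate form descends to `M → R` only after multiplication by some `s ∉ p`, which does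
  -- not affect membership in the prime `p`.
  obtain ⟨φ, s, hφ⟩ := Module.FinitePresentation.exists_lift_of_isLocalizedModule p.primeCompl
    (Algebra.linearMap R (Localization.AtPrime p)) (h := Module.finitePresentation_of_finite R M)
    ((b.coord i).restrictScalars R ∘ₗ f)
  refine ⟨φ, fun hmem => hi ?_⟩
  have h1 := LinearMap.congr_fun hφ a
  simp only [LinearMap.comp_apply, LinearMap.smul_apply, Algebra.linearMap_apply,
    LinearMap.restrictScalars_apply, Module.Basis.coord_apply] at h1
  rw [← IsLocalization.AtPrime.to_map_mem_maximal_iff (Localization.AtPrime p) p, h1,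
    Submonoid.smul_def, Algebra.smul_def] at hmem
  refine ((maximalIdeal.isMaximal _).isPrime.mem_or_mem hmem).resolve_left fun h2 => ?_
  rw [IsLocalization.AtPrime.to_map_mem_maximal_iff (Localization.AtPrime p) p] at h2
  exact s.2 h2

end HeightOne

/-! ### Duality and divisor classes: one cyclic step `A ⊂ B = A + R w` with `B/A ≅ R/p`, then a
filtration. -/

section Dual

variable {R : Type u} [CommRing R]
variable {A B : Type u} [AddCommGroup A] [Module R A] [AddCommGroup B] [Module R B]
  {ι : A →ₗ[R] B} {w : B} {p : Ideal R}

theorem cls_eq_add_cls_range [Module.Finite R A] [Module.Finite R B] (hι : Function.Injective ι) :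
    cls R B = cls R A + cls R (B ⧸ LinearMap.range ι) :=
  cls_eq_add ι (LinearMap.range ι).mkQ hι (LinearMap.exact_map_mkQ_range ι)
    (Submodule.mkQ_surjective _)

theorem cls_quotient_range_eq [Module.Finite R B] (hspan : ∀ b, ∃ a, ∃ r : R, b = ι a + r • w)
    (hp : ∀ r : R, r • w ∈ LinearMap.range ι ↔ r ∈ p) :
    cls R (B ⧸ LinearMap.range ι) = cls R (R ⧸ p) := by
  let g : R →ₗ[R] B ⧸ LinearMap.range ι :=
    (LinearMap.range ι).mkQ ∘ₗ LinearMap.toSpanSingleton R B w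
  have hg : Function.Surjective g := by
    intro b
    obtain ⟨b, rfl⟩ := Submodule.mkQ_surjective _ b
    obtain ⟨a, r, rfl⟩ := hspan b
    refine ⟨r, ?_⟩
    have : (LinearMap.range ι).mkQ (ι a) = 0 := by simp
    rw [map_add, this, zero_add]
    rfl
  have hker : LinearMap.ker g = p := by
    ext r
    rw [LinearMap.mem_ker, ← hp r]
    exact Submodule.Quotient.mk_eq_zero _
  exact (cls_congr (Submodule.quotEquivOfEq _ _ hker.symm ≪≫ₗ
    LinearMap.quotKerEquivOfSurjective g hg)).symm

/-- Extension of a linear form from a submodule to a module with one more generator. -/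
theorem exists_extension (hspan : ∀ b, ∃ a, ∃ r : R, b = ι a + r • w) (ψ : A →ₗ[R] R) (c : R)
    (h : ∀ a r, ι a + r • w = 0 → ψ a + r * c = 0) : ∃ φ : B →ₗ[R] R, φ ∘ₗ ι = ψ := by
  let f : A × R →ₗ[R] B := ι.coprod (LinearMap.toSpanSingleton R B w)
  let g : A × R →ₗ[R] R := ψ.coprod (LinearMap.toSpanSingleton R R c)
  have hf : Function.Surjective f := by
    intro b
    obtain ⟨a, r, rfl⟩ := hspan b
    exact ⟨(a, r), rfl⟩
  have hle : LinearMap.ker f ≤ LinearMap.ker g := fun x hx => h x.1 x.2 hx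
  refine ⟨(LinearMap.ker f).liftQ g hle ∘ₗ (f.quotKerEquivOfSurjective hf).symm.toLinearMap, ?_⟩
  ext a
  have h1 : ι a = f (a, 0) := by simp [f]
  have h2 : (f.quotKerEquivOfSurjective hf).symm (f (a, 0)) = Submodule.Quotient.mk (a, 0) :=
    (LinearEquiv.symm_apply_eq _).mpr rfl
  simp only [LinearMap.comp_apply, h1, LinearEquiv.coe_coe, h2]
  simp [g]

/-- Multiplied by `x`, every relation between `A` and `w` is a consequence of `x w = a₀`; as `x`
cancels in the domain, compatibility with this one relation is enough. -/
theorem exists_extension_of_apply_eq [IsDomain R] (hι : Function.Injective ι)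
    (hspan : ∀ b, ∃ a, ∃ r : R, b = ι a + r • w) {x : R} (hx : x ≠ 0) {a₀ : A}
    (ha₀ : ι a₀ = x • w) (ψ : A →ₗ[R] R) (c : R) (hψ : ψ a₀ = x * c) :
    ∃ φ : B →ₗ[R] R, φ ∘ₗ ι = ψ := by
  refine exists_extension hspan ψ c fun a r har => ?_
  have h1 : x • a + r • a₀ = 0 := by
    apply hι
    rw [map_add, map_smul, map_smul, ha₀, smul_comm r x, ← smul_add, har, smul_zero, map_zero]
  have h2 := congrArg ψ h1
  rw [map_add, map_smul, map_smul, hψ, map_zero, smul_eq_mul, smul_eq_mul] at h2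
  refine (mul_eq_zero.mp ?_).resolve_left hx
  rw [← h2]
  ring

variable (ι) in
/-- Restriction of linear forms along `ι`. -/
def dualRestrict : (B →ₗ[R] R) →ₗ[R] (A →ₗ[R] R) := LinearMap.lcomp R R ι

theorem dualRestrict_injective [IsDomain R] (hspan : ∀ b, ∃ a, ∃ r : R, b = ι a + r • w)
    (hp : ∀ r : R, r • w ∈ LinearMap.range ι ↔ r ∈ p) (hp0 : p ≠ ⊥) :
    Function.Injective (dualRestrict ι) := by
  rw [← LinearMap.ker_eq_bot, LinearMap.ker_eq_bot']
  intro φ hφ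
  obtain ⟨x, hx, hx0⟩ := Submodule.exists_mem_ne_zero_of_ne_bot hp0
  obtain ⟨a₀, ha₀⟩ := (hp x).mpr hx
  have h1 (a : A) : φ (ι a) = 0 := LinearMap.congr_fun hφ a
  have hw : φ w = 0 := by
    have h2 := h1 a₀
    rw [ha₀, map_smul, smul_eq_mul] at h2
    exact (mul_eq_zero.mp h2).resolve_left hx0
  ext b
  obtain ⟨a, r, rfl⟩ := hspan b
  rw [map_add, map_smul, h1, hw, smul_zero, add_zero, LinearMap.zero_apply]

/-- With `r w = a₁`, the extension sends `w` to `ψ a₁`. Thus `p` kills the cokernel of `B* → A*`. -/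
theorem smul_mem_range_dualRestrict [IsDomain R] (hι : Function.Injective ι)
    (hspan : ∀ b, ∃ a, ∃ r : R, b = ι a + r • w)
    (hp : ∀ r : R, r • w ∈ LinearMap.range ι ↔ r ∈ p) (hp0 : p ≠ ⊥) {r : R} (hr : r ∈ p)
    (ψ : A →ₗ[R] R) : r • ψ ∈ LinearMap.range (dualRestrict ι) := by
  obtain ⟨x, hx, hx0⟩ := Submodule.exists_mem_ne_zero_of_ne_bot hp0
  obtain ⟨a₀, ha₀⟩ := (hp x).mpr hx
  obtain ⟨a₁, ha₁⟩ := (hp r).mpr hr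
  refine exists_extension_of_apply_eq hι hspan hx0 ha₀ (r • ψ) (ψ a₁) ?_
  have h1 : r • a₀ = x • a₁ := hι (by rw [map_smul, map_smul, ha₀, ha₁, smul_comm])
  rw [LinearMap.smul_apply, ← map_smul, h1, map_smul, smul_eq_mul]

theorem cls_quotient_eq_zero (h1 : ¬ p.height ≤ 1) : cls R (R ⧸ p) = 0 := by
  refine cls_eq_zero_of_forall fun p' _ hp' m => ?_
  obtain ⟨s, hs, hs'⟩ := SetLike.not_le_iff_exists.mp
    (fun hle : p ≤ p' => h1 ((Ideal.height_mono hle).trans hp'))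
  refine ⟨s, hs', ?_⟩
  obtain ⟨y, rfl⟩ := Ideal.Quotient.mk_surjective m
  rw [Algebra.smul_def, Ideal.Quotient.algebraMap_eq, ← map_mul, Ideal.Quotient.eq_zero_iff_mem]
  exact Ideal.mul_mem_right _ _ hs

variable [IsDomain R] [IsNoetherianRing R] [IsIntegrallyClosed R] [Module.Finite R A]
  [p.IsPrime]

/-- At height one, a form `φ₀` with `φ₀ a₀ ∉ p`, where `a₀ = x w` for a uniformizer `x`, spans a
copy of `R/p` in the cokernel with pseudo-zero quotient. At greater height both sides are
pseudo-zero. -/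
theorem cls_quotient_range_dualRestrict (hι : Function.Injective ι)
    (hspan : ∀ b, ∃ a, ∃ r : R, b = ι a + r • w)
    (hp : ∀ r : R, r • w ∈ LinearMap.range ι ↔ r ∈ p) (hp0 : p ≠ ⊥)
    (hB : IsTorsionFreeInCodimOne R B) :
    cls R ((A →ₗ[R] R) ⧸ LinearMap.range (dualRestrict ι)) = cls R (R ⧸ p) := by
  by_cases h1 : p.height ≤ 1
  · have h1 := height_eq_one_of_ne_bot hp0 h1
    obtain ⟨x, hx, hx0, hxm⟩ := exists_uniformizer h1
    obtain ⟨a₀, ha₀⟩ := (hp x).mpr hx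
    -- If `s a₀ = x b` with `s ∉ p`, then `s w - b` is killed by `x`, so some `u ∉ p` gives `u s w ∈
    -- A`, that is `u s ∈ p`.
    obtain ⟨φ₀, hφ₀⟩ := (hB.of_injective ι hι).exists_dual_notMem h1 hxm a₀ (by
      intro s hs b hb
      have h2 : x • (s • w - ι b) = 0 := by
        rw [smul_sub, smul_comm, ← ha₀, ← map_smul, ← map_smul, hb, sub_self]
      obtain ⟨u, hu, h3⟩ := hB p h1 x _ hx0 h2
      rw [smul_sub, sub_eq_zero, ← mul_smul, ← map_smul] at h3
      have h4 := (hp (u * s)).mp ⟨_, h3.symm⟩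
      exact (‹p.IsPrime›.mem_or_mem h4).elim hu hs)
    have hker : LinearMap.ker ((LinearMap.range (dualRestrict ι)).mkQ ∘ₗ
        LinearMap.toSpanSingleton R (A →ₗ[R] R) φ₀) = p := by
      ext s
      rw [LinearMap.mem_ker, LinearMap.comp_apply, Submodule.mkQ_apply,
        Submodule.Quotient.mk_eq_zero]
      constructor
      · rintro ⟨φ, hφ⟩
        have h2 : φ (ι a₀) = s * φ₀ a₀ := LinearMap.congr_fun hφ a₀
        rw [ha₀, map_smul, smul_eq_mul] at h2
        have h3 : s * φ₀ a₀ ∈ p := h2 ▸ Ideal.mul_mem_right _ _ hx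
        exact (‹p.IsPrime›.mem_or_mem h3).resolve_right hφ₀
      · intro hs
        exact smul_mem_range_dualRestrict hι hspan hp hp0 hs φ₀
    let g : (R ⧸ p) →ₗ[R] (A →ₗ[R] R) ⧸ LinearMap.range (dualRestrict ι) :=
      p.liftQ _ hker.ge
    have hg : Function.Injective g := by
      rw [← LinearMap.ker_eq_bot]
      exact Submodule.ker_liftQ_eq_bot _ _ _ hker.le
    rw [cls_eq_add_cls_range hg, add_eq_left]
    refine cls_eq_zero_of_forall fun p' _ hp' m => ?_
    obtain ⟨m, rfl⟩ := Submodule.mkQ_surjective _ m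
    obtain ⟨ψ, rfl⟩ := Submodule.mkQ_surjective _ m
    by_cases hpp : p = p'
    · subst hpp
      -- The form `(φ₀ a₀) ψ - (ψ a₀) φ₀` vanishes at `a₀`, so it extends to `B` by `w ↦ 0`. Hence
      -- `φ₀ a₀` carries `ψ` into the span of `φ₀`.
      refine ⟨φ₀ a₀, hφ₀, ?_⟩
      rw [← map_smul, ← map_smul, Submodule.mkQ_apply, Submodule.Quotient.mk_eq_zero]
      refine ⟨Ideal.Quotient.mk p (ψ a₀), ?_⟩
      have h2 : g (Ideal.Quotient.mk p (ψ a₀)) =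
        (LinearMap.range (dualRestrict ι)).mkQ (ψ a₀ • φ₀) := rfl
      rw [h2, ← sub_eq_zero, ← map_sub, Submodule.mkQ_apply, Submodule.Quotient.mk_eq_zero]
      refine exists_extension_of_apply_eq hι hspan hx0 ha₀ _ 0 ?_
      simp only [LinearMap.sub_apply, LinearMap.smul_apply, smul_eq_mul]
      ring
    · obtain ⟨s, hs, hs'⟩ := SetLike.not_le_iff_exists.mp
        (fun hle : p ≤ p' => hpp (eq_of_le_of_height_eq_one hle h1 hp'))
      refine ⟨s, hs', ?_⟩
      rw [← map_smul, ← map_smul, Submodule.mkQ_apply, Submodule.Quotient.mk_eq_zero,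
        Submodule.mkQ_apply, (Submodule.Quotient.mk_eq_zero _).mpr
          (smul_mem_range_dualRestrict hι hspan hp hp0 hs ψ)]
      exact Submodule.zero_mem _
  · rw [cls_quotient_eq_zero h1]
    refine cls_eq_zero_of_forall fun p' _ hp' m => ?_
    obtain ⟨s, hs, hs'⟩ := SetLike.not_le_iff_exists.mp
      (fun hle : p ≤ p' => h1 ((Ideal.height_mono hle).trans hp'))
    refine ⟨s, hs', ?_⟩
    obtain ⟨ψ, rfl⟩ := Submodule.mkQ_surjective _ m
    rw [← map_smul, Submodule.mkQ_apply, Submodule.Quotient.mk_eq_zero]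
    exact smul_mem_range_dualRestrict hι hspan hp hp0 hs ψ

/-- For `p ≠ 0` the step adds `[R/p]` to the class of the module and removes it from that of the
dual. For `p = 0` it splits as `B ≅ A × R`, and each class grows by `[R]`; so `k` counts the steps
with `p = 0`. -/
theorem cls_add_cls_dual_step [Module.Finite R B] (hι : Function.Injective ι)
    (hspan : ∀ b, ∃ a, ∃ r : R, b = ι a + r • w)
    (hp : ∀ r : R, r • w ∈ LinearMap.range ι ↔ r ∈ p) (hB : IsTorsionFreeInCodimOne R B)
    (hA : ∃ k : ℕ, cls R A + cls R (A →ₗ[R] R) = (2 * k) • cls R R) :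
    ∃ k : ℕ, cls R B + cls R (B →ₗ[R] R) = (2 * k) • cls R R := by
  obtain ⟨k, hk⟩ := hA
  by_cases hp0 : p = ⊥
  · refine ⟨k + 1, ?_⟩
    let f : A × R →ₗ[R] B := ι.coprod (LinearMap.toSpanSingleton R B w)
    have hf : Function.Bijective f := by
      refine ⟨?_, fun b => ?_⟩
      · rw [← LinearMap.ker_eq_bot, LinearMap.ker_eq_bot']
        rintro ⟨a, r⟩ h
        have h1 : ι a + r • w = 0 := h
        have h2 : r = 0 := by
          have := (hp r).mp ⟨-a, by rw [map_neg, neg_eq_iff_add_eq_zero, h1]⟩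
          rwa [hp0] at this
        subst h2
        rw [zero_smul, add_zero] at h1
        rw [hι (h1.trans (map_zero ι).symm)]
        rfl
      · obtain ⟨a, r, rfl⟩ := hspan b
        exact ⟨(a, r), rfl⟩
    let e := LinearEquiv.ofBijective f hf
    have h1 : cls R (B →ₗ[R] R) = cls R (A →ₗ[R] R) + cls R R := by
      rw [← cls_congr (LinearEquiv.congrLeft R R e), ← cls_congr (LinearMap.coprodEquiv R),
        cls_prod, cls_congr (LinearMap.ringLmapEquivSelf R R R)]
    rw [← cls_congr e, cls_prod, h1, mul_add, add_smul, ← hk, mul_one, two_smul]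
    abel
  · refine ⟨k, ?_⟩
    have h1 := cls_eq_add_cls_range (dualRestrict_injective hspan hp hp0)
    rw [cls_quotient_range_dualRestrict hι hspan hp hp0 hB] at h1
    rw [← hk, h1, cls_eq_add_cls_range hι, cls_quotient_range_eq hspan hp]
    abel

end Dual

/-- Over a normal domain the classes of a module and of its dual have opposite divisor classes. -/
theorem exists_cls_add_cls_dual {R : Type u} [CommRing R] [IsDomain R] [IsNoetherianRing R]
    [IsIntegrallyClosed R] {N : Type u} [AddCommGroup N] [Module R N] [Module.Finite R N]
    (hN : IsTorsionFreeInCodimOne R N) :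
    ∃ k : ℕ, cls R N + cls R (N →ₗ[R] R) = (2 * k) • cls R R := by
  suffices h : ∃ k : ℕ, cls R (⊤ : Submodule R N) + cls R ((⊤ : Submodule R N) →ₗ[R] R) =
      (2 * k) • cls R R by
    rwa [cls_congr Submodule.topEquiv, cls_congr (LinearEquiv.congrLeft R R Submodule.topEquiv)]
      at h
  refine WellFoundedGT.induction_top (P := fun N' : Submodule R N =>
    ∃ k : ℕ, cls R N' + cls R (N' →ₗ[R] R) = (2 * k) • cls R R) ⟨⊥, 0, ?_⟩ ?_
  · rw [cls_eq_zero_of_subsingleton, cls_eq_zero_of_subsingleton, mul_zero, zero_nsmul, add_zero]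
  · intro N' hN' hk
    have := Submodule.Quotient.nontrivial_iff.mpr hN'
    -- Adjoining a lift of an element whose annihilator is an associated prime of `N/N'` enlarges
    -- `N'` by a cyclic step of the required kind.
    obtain ⟨p, hp⟩ := associatedPrimes.nonempty R (N ⧸ N')
    rw [AssociatedPrimes.mem_iff, isAssociatedPrime_iff] at hp
    obtain ⟨hp, w, hw⟩ := hp
    obtain ⟨w, rfl⟩ := Submodule.mkQ_surjective _ w
    have hmem (r : R) : r ∈ p ↔ r • w ∈ N' := by
      rw [hw, Submodule.mem_colon_singleton, Submodule.mem_bot, ← map_smul, Submodule.mkQ_apply,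
        Submodule.Quotient.mk_eq_zero]
    have hwN : w ∉ N' := fun h => hp.ne_top ((Ideal.eq_top_iff_one p).mpr
      ((hmem 1).mpr (by rwa [one_smul])))
    have hw' : w ∈ N' ⊔ Submodule.span R {w} :=
      Submodule.mem_sup_right (Submodule.mem_span_singleton_self w)
    refine ⟨N' ⊔ Submodule.span R {w}, lt_of_le_of_ne le_sup_left fun h => hwN (h ▸ hw'), ?_⟩
    refine cls_add_cls_dual_step (p := p) (ι := Submodule.inclusion le_sup_left) (w := ⟨w, hw'⟩)
      (Submodule.inclusion_injective _) ?_ ?_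
      (hN.of_injective (Submodule.subtype _) (Submodule.subtype_injective _)) hk
    · rintro ⟨b, hb⟩
      obtain ⟨a, ha, y, hy, rfl⟩ := Submodule.mem_sup.mp hb
      obtain ⟨r, rfl⟩ := Submodule.mem_span_singleton.mp hy
      exact ⟨⟨a, ha⟩, r, rfl⟩
    · intro r
      rw [hmem]
      constructor
      · rintro ⟨a, ha⟩
        have h : (a : N) = r • w := congrArg Subtype.val ha
        exact h ▸ a.2
      · intro h
        exact ⟨⟨r • w, h⟩, rfl⟩

/-! ### Cones and order units. -/

section Cone

variable {E F : Type*} [AddCommGroup E] [Module ℝ E] [AddCommGroup F] [Module ℝ F]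

theorem IsPolyhedral.map {C : PointedCone ℝ E} (hC : IsPolyhedral C) (f : E →ₗ[ℝ] F) :
    IsPolyhedral (C.map f) := by
  classical
  obtain ⟨t, rfl⟩ := hC
  refine ⟨t.image f, ?_⟩
  rw [Finset.coe_image]
  exact Submodule.map_span (f.restrictScalars {c : ℝ // 0 ≤ c}) (t : Set E)

/-- The vectors `w` such that both `w` and `-w` can be moved into the cone `C` by adding a
multiple of `v`. -/
def absorbed (C : PointedCone ℝ E) (v : E) : Submodule ℝ E where
  carrier := {w | ∃ K : ℝ, 0 ≤ K ∧ K • v + w ∈ C ∧ K • v - w ∈ C}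
  zero_mem' := ⟨0, le_rfl, by simp, by simp⟩
  add_mem' := by
    rintro w w' ⟨K, hK, h1, h2⟩ ⟨K', hK', h1', h2'⟩
    refine ⟨K + K', add_nonneg hK hK', ?_, ?_⟩
    · convert C.add_mem h1 h1' using 1
      rw [add_smul]; abel
    · convert C.add_mem h2 h2' using 1
      rw [add_smul]; abel
  smul_mem' := by
    rintro r w ⟨K, hK, h1, h2⟩
    rcases le_total 0 r with hr | hr
    · refine ⟨r * K, mul_nonneg hr hK, ?_, ?_⟩
      · convert PointedCone.smul_mem _ hr h1 using 1
        rw [smul_add, mul_smul]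
      · convert PointedCone.smul_mem _ hr h2 using 1
        rw [smul_sub, mul_smul]
    · have hr' : 0 ≤ -r := neg_nonneg.mpr hr
      refine ⟨-r * K, mul_nonneg hr' hK, ?_, ?_⟩
      · convert PointedCone.smul_mem _ hr' h2 using 1
        rw [smul_sub, mul_smul, neg_smul _ w, sub_neg_eq_add]
      · convert PointedCone.smul_mem _ hr' h1 using 1
        rw [smul_add, mul_smul, neg_smul _ w, sub_eq_add_neg]

/-- The line `v + t w` stays in `C` for small `t > 0`; rescale by `t⁻¹`. -/
theorem exists_smul_add_mem_of_mem_coneInterior {C : PointedCone ℝ E} {v : E}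
    (hv : v ∈ coneInterior C) (w : E) : ∃ K : ℝ, 0 ≤ K ∧ K • v + w ∈ C := by
  let : TopologicalSpace E := moduleTopology ℝ E
  have : IsModuleTopology ℝ E := ⟨rfl⟩
  have : ContinuousSMul ℝ E := IsModuleTopology.toContinuousSMul ℝ E
  have : ContinuousAdd E := IsModuleTopology.toContinuousAdd ℝ E
  have hcont : Continuous fun t : ℝ => v + t • w := by fun_prop
  have hnhds : (C : Set E) ∈ nhds (v + (0 : ℝ) • w) := by
    rw [zero_smul, add_zero]
    exact mem_interior_iff_mem_nhds.mp hv
  have h1 : ∀ᶠ t in nhds (0 : ℝ), v + t • w ∈ C := hcont.continuousAt.eventually hnhds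
  obtain ⟨ε, hε, h⟩ := Metric.eventually_nhds_iff.mp h1
  have h2 : v + (ε / 2) • w ∈ C := h (by
    rw [Real.dist_0_eq_abs, abs_of_pos (by positivity)]; linarith)
  refine ⟨(ε / 2)⁻¹, by positivity, ?_⟩
  convert PointedCone.smul_mem _ (by positivity : 0 ≤ (ε / 2)⁻¹) h2 using 1
  rw [smul_add, smul_smul, inv_mul_cancel₀ (by positivity), one_smul]

end Cone

/-! ### Classes and depths of syzygies, and complexity. -/

section Syzygies

variable {R : Type u} [CommRing R]

theorem IsMCM.realClass_mem {M : Type u} [AddCommGroup M] [Module R M] [Module.Finite R M]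
    (h : IsMCM R M) : realClass R M ∈ cmCone R :=
  Submodule.subset_span ⟨FGModuleCat.of R M, h, rfl⟩

theorem minimalCover_surjective (M : FGModuleCat.{u} R) :
    Function.Surjective (minimalCover R M) := by
  rw [← LinearMap.range_eq_top, minimalCover, Fintype.range_linearCombination]
  exact (exists_minimalGenerators R M).choose_spec

variable [IsNoetherianRing R]

theorem realClass_firstSyzygy (M : FGModuleCat.{u} R) :
    realClass R (firstSyzygy R M) = (minGen R M : ℝ) • realClass R R - realClass R M := by
  have h := realClass_eq_add (LinearMap.ker (minimalCover R M)).subtype (minimalCover R M)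
    (Submodule.subtype_injective _) (LinearMap.exact_subtype_ker_map _)
    (minimalCover_surjective M)
  rw [← toReal_cls (M := Fin _ → R), cls_pi, map_nsmul, toReal_cls] at h
  rw [Nat.cast_smul_eq_nsmul, h, add_sub_cancel_right]
  rfl

theorem syzygy_succ (n : ℕ) (M : FGModuleCat.{u} R) :
    syzygy R (n + 1) M = firstSyzygy R (syzygy R n M) :=
  Function.iterate_succ_apply' _ _ _

/-- The coefficient of `[R]` in the class of the `n`-th syzygy: the alternating sum
`β (n - 1) - β (n - 2) + ⋯`. -/
noncomputable def bettiSum (M : FGModuleCat.{u} R) : ℕ → ℝ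
  | 0 => 0
  | n + 1 => betti R n M - bettiSum M n

theorem realClass_syzygy (n : ℕ) (M : FGModuleCat.{u} R) :
    realClass R (syzygy R n M) =
      bettiSum M n • realClass R R + (-1 : ℝ) ^ n • realClass R M := by
  induction n with
  | zero => rw [bettiSum, zero_smul, pow_zero, one_smul, zero_add]; rfl
  | succ n ih =>
    have h := realClass_firstSyzygy (syzygy R n M)
    rw [← syzygy_succ, ih] at h
    rw [h, bettiSum, pow_succ, mul_neg_one, neg_smul, sub_smul, betti]
    abel

/-- By the depth lemma each syzygy gains one in depth until the height of `q` is reached. Only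
exactness is used, so it does not matter that minimality may be lost on localizing. -/
theorem hasDepthAt_syzygy (hR : IsCohenMacaulay R) (M : FGModuleCat.{u} R) {q : Ideal R}
    [q.IsPrime] {d : ℕ} (hd : q.height = d) (n : ℕ) :
    HasDepthAt q (min n d) (syzygy R n M) := by
  induction n with
  | zero => rw [Nat.zero_min]; exact HasRegularSequence.zero
  | succ n ih =>
    rw [syzygy_succ]
    have key (k : ℕ) (hk : k + 1 ≤ d) (hk' : k ≤ n) :
        HasDepthAt q (k + 1) (firstSyzygy R (syzygy R n M)) :=
      HasDepthAt.kernel (LinearMap.ker (minimalCover R (syzygy R n M))).subtype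
        (minimalCover R (syzygy R n M)) (Submodule.subtype_injective _)
        (LinearMap.exact_subtype_ker_map _) (minimalCover_surjective _)
        (HasRegularSequence.mono hk (hR.hasDepthAt hd))
        (HasRegularSequence.mono (le_min hk' (by omega)) ih)
    cases hm : min (n + 1) d with
    | zero => exact HasRegularSequence.zero
    | succ k => exact key k (by omega) (by omega)

theorem isMCM_of_isCohenMacaulay (hR : IsCohenMacaulay R) : IsMCM R R :=
  isMCM_iff.mpr fun _ _ _ hn => hR.hasDepthAt hn

/-- Over a Cohen-Macaulay local ring, high syzygies are maximal Cohen-Macaulay. -/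
theorem exists_forall_isMCM_syzygy [IsLocalRing R] (hR : IsCohenMacaulay R) :
    ∃ d : ℕ, ∀ (M : FGModuleCat.{u} R) (n : ℕ), d ≤ n → IsMCM R (syzygy R n M) := by
  have := Ideal.finiteHeight_of_isNoetherianRing (IsLocalRing.maximalIdeal R)
  obtain ⟨d, hd⟩ := ENat.ne_top_iff_exists.mp (Ideal.height_ne_top
    (I := IsLocalRing.maximalIdeal R) (Ideal.IsPrime.ne_top inferInstance))
  refine ⟨d, fun M n hn => isMCM_iff.mpr fun q _ m hm => ?_⟩
  have hle := Ideal.height_mono (IsLocalRing.le_maximalIdeal_of_isPrime q)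
  rw [hm, ← hd] at hle
  have hle : m ≤ d := by exact_mod_cast hle
  have h := hasDepthAt_syzygy hR M hm n
  rwa [min_eq_right (hle.trans hn)] at h

/-- The class of a Cohen-Macaulay local ring is an order unit for its Cohen-Macaulay cone. -/
theorem mem_absorbed_realClass [IsLocalRing R] (hR : IsCohenMacaulay R)
    (w : HReal R) : w ∈ absorbed (cmCone R) (realClass R R) := by
  -- Vectors absorbed with both signs form a subspace, so classes of modules suffice. For these, a
  -- high even and a high odd syzygy, `2d` and `2d + 1`, provide the two signs.
  refine mem_of_forall_realClass_mem _ (fun X => ?_) w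
  obtain ⟨d, hd⟩ := exists_forall_isMCM_syzygy hR
  have hv := (isMCM_of_isCohenMacaulay hR).realClass_mem
  have key (n : ℕ) (hn : d ≤ n) (K : ℝ) (hK : bettiSum X n ≤ K) :
      K • realClass R R + (-1 : ℝ) ^ n • realClass R X ∈ cmCone R := by
    have h1 := (hd X n hn).realClass_mem
    have h2 := realClass_syzygy n X
    have h3 := (cmCone R).add_mem h1 (PointedCone.smul_mem _ (sub_nonneg.mpr hK) hv)
    convert h3 using 1
    refine Eq.trans ?_ (congrArg (· + (K - bettiSum X n) • realClass R R) h2.symm)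
    rw [sub_smul]
    abel
  obtain ⟨K, hK, h₀, h₁⟩ : ∃ K : ℝ, 0 ≤ K ∧ bettiSum X (2 * d) ≤ K ∧ bettiSum X (2 * d + 1) ≤ K :=
    ⟨max 0 (max (bettiSum X (2 * d)) (bettiSum X (2 * d + 1))), by simp, by simp, by simp⟩
  refine ⟨K, hK, ?_, ?_⟩
  · have h := key (2 * d) (by omega) K h₀
    rwa [pow_mul, neg_one_sq, one_pow, one_smul] at h
  · have h := key (2 * d + 1) (by omega) K h₁
    rwa [pow_succ, pow_mul, neg_one_sq, one_pow, one_mul, neg_smul, one_smul,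
      ← sub_eq_add_neg] at h

/-- If `[R]` is an order unit for the cone `V`, then every module of complexity at least two
has infinitely many syzygies with class in `V`. -/
theorem infinite_setOf_realClass_syzygy_mem (V : PointedCone ℝ (HReal R))
    (hV : ∀ w, ∃ K : ℝ, 0 ≤ K ∧ K • realClass R R + w ∈ V) (M : FGModuleCat.{u} R)
    (hM : 2 ≤ complexity R M) : {n : ℕ | realClass R (syzygy R n M) ∈ V}.Infinite := by
  -- Needed so that a constant `K` that works can be replaced by any larger one.
  have hR : realClass R R ∈ V := by
    obtain ⟨K, hK, h⟩ := hV (realClass R R)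
    have h1 : (K + 1) • realClass R R ∈ V := by rwa [add_smul, one_smul]
    have h2 := PointedCone.smul_mem _ (by positivity : 0 ≤ (K + 1)⁻¹) h1
    rwa [smul_smul, inv_mul_cancel₀ (by positivity), one_smul] at h2
  have hV' (w : HReal R) : ∃ K : ℝ, ∀ b, K ≤ b → b • realClass R R + w ∈ V := by
    obtain ⟨K, hK, h⟩ := hV w
    refine ⟨K, fun b hb => ?_⟩
    convert V.add_mem h (PointedCone.smul_mem _ (sub_nonneg.mpr hb) hR) using 1
    rw [sub_smul]
    abel
  obtain ⟨K₁, hK₁⟩ := hV' (realClass R M)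
  obtain ⟨K₂, hK₂⟩ := hV' (-realClass R M)
  have hmem (n : ℕ) (hn : max K₁ K₂ ≤ bettiSum M n) : realClass R (syzygy R n M) ∈ V := by
    rw [realClass_syzygy]
    rcases neg_one_pow_eq_or ℝ n with h | h
    · rw [h, one_smul]
      exact hK₁ _ ((le_max_left _ _).trans hn)
    · rw [h, neg_smul, one_smul]
      exact hK₂ _ ((le_max_right _ _).trans hn)
  intro hfin
  obtain ⟨n₀, hn₀⟩ := hfin.bddAbove
  have hlt (n : ℕ) (hn : n₀ < n) : bettiSum M n < max K₁ K₂ := by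
    by_contra! h
    exact absurd (hn₀ (hmem n h)) (not_le.mpr hn)
  -- An upper bound on `bettiSum` bounds the Betti numbers, each being the sum of two consecutive
  -- values. The absolute value only makes the constant visibly nonnegative.
  have hc : complexity R M ≤ (1 : ℕ) := by
    refine iInf₂_le 1 ⟨|2 * max K₁ K₂|, abs_nonneg _, ?_⟩
    filter_upwards [Filter.eventually_gt_atTop n₀] with n hn
    have h1 := hlt n hn
    have h2 := hlt (n + 1) (by omega)
    rw [bettiSum] at h2
    rw [Nat.cast_one, sub_self, zpow_zero, mul_one]
    refine le_trans ?_ (le_abs_self _)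
    linarith
  have h2 := hM.trans hc
  norm_num at h2

end Syzygies

/-! ### The class of `R` as an order unit of the image cone. -/

section Extension

variable (R S : Type u) [CommRing R] [CommRing S] [Algebra R S]

theorem imageCone_le_cmCone [IsNoetherianRing R] [IsIntegrallyClosed R] [IsDomain S]
    [IsNoetherianRing S] [FaithfulSMul R S] [Module.Finite R S] : imageCone R S ≤ cmCone R := by
  refine (Submodule.map_span_le _ _ _).mpr ?_
  rintro _ ⟨X, hX, rfl⟩
  let : Module R X := Module.compHom X (algebraMap R S)
  have : IsScalarTower R S X := IsScalarTower.of_algebraMap_smul fun _ _ => rfl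
  have : Module.Finite R X := Module.Finite.trans S X
  change realRestrict R S (realClass S X) ∈ cmCone R
  rw [realRestrict_realClass]
  exact (IsMCM.restrictScalars hX).realClass_mem

theorem isTorsionFreeInCodimOne_of_faithfulSMul [IsDomain S] [FaithfulSMul R S] :
    IsTorsionFreeInCodimOne R S := by
  intro p _ _ r s hr hrs
  rw [Algebra.smul_def, mul_eq_zero, FaithfulSMul.algebraMap_eq_zero_iff] at hrs
  exact ⟨1, (Ideal.ne_top_iff_one p).mp ‹p.IsPrime›.ne_top, by
    rw [hrs.resolve_left hr, smul_zero]⟩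

variable {R S} [IsNoetherianRing R] [Module.Finite R S]

/-- Lift `w` to `H(S)_ℝ`, absorb it there by `[N ⊕ N*]`, and map back: the absorbing class becomes
`2k [R]`. -/
theorem exists_smul_realClass_add_mem_imageCone [IsDomain R] [IsIntegrallyClosed R]
    [FaithfulSMul R S] {N : Type u} [AddCommGroup N] [Module R N]
    [Module S N] [IsScalarTower R S N] [Module.Finite S N] (hN : IsTorsionFreeInCodimOne R N)
    (h : ∀ w, ∃ K : ℝ, 0 ≤ K ∧ K • realClass S (N × RDual R S N) + w ∈ cmCone S) (w : HReal R) :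
    ∃ K : ℝ, 0 ≤ K ∧ K • realClass R R + w ∈ imageCone R S := by
  have : Module.Finite R N := Module.Finite.trans S N
  have : Module.Finite R (RDual R S N) := Module.Finite.trans S _
  obtain ⟨k, hk⟩ := exists_cls_add_cls_dual hN
  have hdual : realClass R (N × RDual R S N) = ((2 * k : ℕ) : ℝ) • realClass R R := by
    rw [← toReal_cls, cls_prod, Nat.cast_smul_eq_nsmul, ← toReal_cls, ← map_nsmul]
    exact congrArg _ hk
  obtain ⟨w, rfl⟩ := realRestrict_surjective R S w
  obtain ⟨K, hK, hw⟩ := h w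
  refine ⟨K * (2 * k : ℕ), by positivity, ?_⟩
  rw [mul_smul, ← hdual, ← realRestrict_realClass R S (N × RDual R S N), ← map_smul, ← map_add]
  exact Submodule.mem_map_of_mem hw

/-- The class `[S]` already absorbs `w`, and the dual of `S` contributes a further element of the
cone. -/
theorem exists_smul_realClass_add_mem_cmCone [IsNoetherianRing S] [IsLocalRing S]
    (hS : IsCohenMacaulay S)
    (h : IsMCM R (S →ₗ[R] R)) (w : HReal S) :
    ∃ K : ℝ, 0 ≤ K ∧ K • realClass S (S × RDual R S S) + w ∈ cmCone S := by
  have hdual : IsMCM R (RDual R S S) := h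
  obtain ⟨K, hK, hw, -⟩ := mem_absorbed_realClass hS w
  refine ⟨K, hK, ?_⟩
  rw [realClass_prod, smul_add, add_right_comm]
  exact (cmCone S).add_mem hw
    (PointedCone.smul_mem _ hK (IsMCM.of_restrictScalars (R := R) hdual).realClass_mem)

end Extension

end GrothendieckCone

theorem theorem1p2 (R S : Type u) [CommRing R] [CommRing S]
    [IsDomain R] [IsLocalRing R] [IsNoetherianRing R]
    [IsDomain S] [IsLocalRing S] [IsNoetherianRing S]
    [Algebra R S] [FaithfulSMul R S] [Module.Finite R S] [IsIntegrallyClosed R]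
    (hR : GrothendieckCone.IsCohenMacaulay R) (hS : GrothendieckCone.IsCohenMacaulay S)
    (hfin : FiniteDimensional ℝ (GrothendieckCone.HReal S))
    (hpoly : GrothendieckCone.IsPolyhedral (GrothendieckCone.cmCone S)) :
    Function.Surjective (GrothendieckCone.realRestrict R S) ∧
    GrothendieckCone.IsPolyhedral (GrothendieckCone.imageCone R S) ∧
    GrothendieckCone.imageCone R S ≤ GrothendieckCone.cmCone R ∧
    ∀ M : FGModuleCat.{u} R, 2 ≤ GrothendieckCone.complexity R M →
      GrothendieckCone.IsLocallyFreeInCodimOne R M →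
      ((∃ (N : Type u) (_ : AddCommGroup N) (_ : Module R N) (_ : Module S N)
          (_ : IsScalarTower R S N) (_ : Module.Finite S N),
          GrothendieckCone.IsLocallyFreeInCodimOne R N ∧
          GrothendieckCone.realClass S (N × GrothendieckCone.RDual R S N) ∈
            GrothendieckCone.coneInterior (GrothendieckCone.cmCone S)) ∨
        GrothendieckCone.IsMCM R (S →ₗ[R] R)) →
      {n : ℕ | GrothendieckCone.realClass R (GrothendieckCone.syzygy R n M) ∈
        GrothendieckCone.imageCone R S}.Infinite := by
  open GrothendieckCone in
  refine ⟨realRestrict_surjective R S, hpoly.map _, imageCone_le_cmCone R S,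
    fun M hM _ hcond => infinite_setOf_realClass_syzygy_mem _ ?_ M hM⟩
  rcases hcond with ⟨N, _, _, _, _, _, hN, hint⟩ | hdual
  · exact exists_smul_realClass_add_mem_imageCone hN.isTorsionFreeInCodimOne
      fun w => exists_smul_add_mem_of_mem_coneInterior hint w
  -- Here `S` itself plays the role of `N`.
  · exact exists_smul_realClass_add_mem_imageCone (isTorsionFreeInCodimOne_of_faithfulSMul R S)
      (exists_smul_realClass_add_mem_cmCone hS hdual)
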